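/- An information graph $G=(V,E,\alpha)$ is a connected finite simple graph together with a probability $\alpha\in(0,1]$. Keep every edge of $G$ independently with probability $\alpha$; the proximity of $u,v\in V$ is the probability that $u$ and $v$ are connected in the resulting random subgraph, and the broadcast $\beta(G)$ is the minimum of the proximities over all pairs of vertices. For a set $F\subseteq V^2\setminus E$ of non-edges, $G+F$ denotes $(V,E\cup F,\alpha)$, and for an integer $k\ge 0$ let $\beta^*=\beta^*(G,k)$ be the maximum of $\beta(G+F)$ over all sets $F$ of at most $k$ non-edges of $G$. Algorithms are programs with exact real arithmetic (the real field operations, comparisons, and natural numbers as the only constants; no rounding) and addition, subtraction and comparison of natural numbers, which may call an oracle that returns the proximity of two given vertices in $G+F$ for the current edge set $F$; every instruction, test and oracle call counts as one step. Theorem. For every $\varepsilon>0$ there is a constant $C=C(\varepsilon)$ such that for every $\alpha\in(0,1]$ there is an algorithm, whose number of steps is bounded by a polynomial in $n$ (the algorithm and the polynomial may depend on $\varepsilon$ and $\alpha$), with the following property. Given an information graph $G=(V,E,\alpha)$ with $|V|=n$ and an integer $k\ge 0$, it outputs a set $F\subseteq V^2\setminus E$ of non-edges with $$|F|\le C\,k\log_2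 n \qquad\text{and}\qquad \beta(G+F)\ \ge\ \frac{\beta^*(G,k)\,\alpha^{2+\varepsilon}}{(1+\varepsilon)(24k^2+6)} .$$ -/

import Mathlib

namespace BroadcastImprovement

/-! Information graphs `(V, E, α)`: a simple graph `G` on `V` and a sampling probability `α`. -/

open Classical in
/-- Proximity of `u` and `v`: every edge of `G` is kept independently with probability `α`, and this
is the probability that `u` and `v` are connected in the sampled graph, as a sum over the set `A`
of the edges that are kept. -/
noncomputable def proximity {V : Type*} [Fintype V] (G : SimpleGraph V) (α : ℝ) (u v : V) : ℝ :=
  ∑ A ∈ G.edgeFinset.powerset,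
    if (SimpleGraph.fromEdgeSet (A : Set (Sym2 V))).Reachable u v then
      α ^ A.card * (1 - α) ^ (G.edgeFinset.card - A.card)
    else 0

/-- The broadcast: the least proximity over all pairs of vertices. -/
noncomputable def broadcast {V : Type*} [Fintype V] (G : SimpleGraph V) (α : ℝ) : ℝ :=
  ⨅ p : V × V, proximity G α p.1 p.2

/-- `G + F`: the graph `G` with the edges of `F` added. -/
def addEdges {V : Type*} (G : SimpleGraph V) (F : Finset (Sym2 V)) : SimpleGraph V :=
  G ⊔ SimpleGraph.fromEdgeSet (F : Set (Sym2 V))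

open Classical in
/-- The sets of at most `k` edges that can be added to `G`. -/
noncomputable def candidates {V : Type*} [Fintype V] (G : SimpleGraph V) (k : ℕ) :
    Finset (Finset (Sym2 V)) :=
  Gᶜ.edgeFinset.powerset.filter (fun F => F.card ≤ k)

theorem candidates_nonempty {V : Type*} [Fintype V] (G : SimpleGraph V) (k : ℕ) :
    (candidates G k).Nonempty :=
  ⟨∅, by simp [candidates]⟩

/-- The optimum `β*`: the largest broadcast that can be reached by adding (at most) `k` edges. -/
noncomputable def optBroadcast {V : Type*} [Fintype V] (G : SimpleGraph V) (α : ℝ) (k : ℕ) : ℝ :=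
  (candidates G k).sup' (candidates_nonempty G k) (fun F => broadcast (addEdges G F) α)

/-! Algorithms: structured programs for a random access machine with a memory of natural numbers,
a memory of real numbers, and a set `F` of edges that it builds. Real arithmetic is exact, there is
no rounding, the only constants are natural numbers, and natural numbers can only be
added, subtracted and compared. An oracle returns proximities in the current graph `G + F`.
Every instruction, every test and every oracle call costs one step. -/

/-- Instructions; `d`, `a`, `b` are fixed addresses, `N[_]` and `R[_]` are the two memories. -/
inductive Instr : Type
  /-- `N[d] := c` -/
  | natConst (d c : ℕ)
  /-- `N[d] := N[a]` -/
  | natCopy (d a : ℕ)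
  /-- `N[d] := N[a] + N[b]` -/
  | natAdd (d a b : ℕ)
  /-- `N[d] := N[a] - N[b]`, truncated at `0` -/
  | natSub (d a b : ℕ)
  /-- `N[d] := N[N[a]]` -/
  | natLoad (d a : ℕ)
  /-- `N[N[a]] := N[b]` -/
  | natStore (a b : ℕ)
  /-- `R[d] := c` -/
  | realConst (d c : ℕ)
  /-- `R[d] := N[a]` -/
  | realOfNat (d a : ℕ)
  /-- `R[d] := R[a]` -/
  | realCopy (d a : ℕ)
  /-- `R[d] := R[a] + R[b]` -/
  | realAdd (d a b : ℕ)
  /-- `R[d] := R[a] - R[b]` -/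
  | realSub (d a b : ℕ)
  /-- `R[d] := R[a] * R[b]` -/
  | realMul (d a b : ℕ)
  /-- `R[d] := R[a] / R[b]`, where a quotient by `0` is `0` -/
  | realDiv (d a b : ℕ)
  /-- `R[d] := R[N[a]]` -/
  | realLoad (d a : ℕ)
  /-- `R[N[a]] := R[b]` -/
  | realStore (a b : ℕ)
  /-- put the pair of the vertices `N[a]` and `N[b]` into `F` -/
  | insertEdge (a b : ℕ)
  /-- remove the pair of the vertices `N[a]` and `N[b]` from `F` -/
  | eraseEdge (a b : ℕ)
  /-- oracle call: `R[d] :=` the proximity of the vertices `N[a]` and `N[b]` in `G + F` -/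
  | query (d a b : ℕ)

/-- Tests. -/
inductive Test : Type
  /-- `N[a] < N[b]` -/
  | natLt (a b : ℕ)
  /-- `R[a] < R[b]` -/
  | realLt (a b : ℕ)
  /-- the vertices `N[a]` and `N[b]` are adjacent in the input graph `G` -/
  | isEdge (a b : ℕ)
  /-- the pair of the vertices `N[a]` and `N[b]` is in `F` -/
  | isAdded (a b : ℕ)

/-- Programs. -/
inductive Program : Type
  | instr (i : Instr)
  | seq (P Q : Program)
  /-- if `c` holds then `P` else `Q` -/
  | ite (c : Test) (P Q : Program)
  /-- while `c` holds do `P` -/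
  | loop (c : Test) (P : Program)

/-- The state of a machine that runs on a graph with the vertices `0, …, n - 1`. -/
structure Store (n : ℕ) : Type where
  nat : ℕ → ℕ
  real : ℕ → ℝ
  edges : Finset (Sym2 (Fin n))

/-- The start: `N[0] = n`, `N[1] = k`, `R[0] = α`, all other cells are `0`, and `F` is empty. -/
noncomputable def Store.init (n k : ℕ) (α : ℝ) : Store n where
  nat := fun a => if a = 0 then n else if a = 1 then k else 0
  real := fun a => if a = 0 then α else 0
  edges := ∅

/-- `N[d] := x` -/
def Store.setNat {n : ℕ} (s : Store n) (d x : ℕ) : Store n :=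
  { s with nat := Function.update s.nat d x }

/-- `R[d] := x` -/
def Store.setReal {n : ℕ} (s : Store n) (d : ℕ) (x : ℝ) : Store n :=
  { s with real := Function.update s.real d x }

/-- The effect of an instruction. Edge instructions on numbers that are not vertices do nothing,
and the oracle answers `0` for them. -/
noncomputable def Instr.exec {n : ℕ} (G : SimpleGraph (Fin n)) (α : ℝ) (s : Store n) :
    Instr → Store n
  | .natConst d c => s.setNat d c
  | .natCopy d a => s.setNat d (s.nat a)
  | .natAdd d a b => s.setNat d (s.nat a + s.nat b)
  | .natSub d a b => s.setNat d (s.nat a - s.nat b)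
  | .natLoad d a => s.setNat d (s.nat (s.nat a))
  | .natStore a b => s.setNat (s.nat a) (s.nat b)
  | .realConst d c => s.setReal d (c : ℝ)
  | .realOfNat d a => s.setReal d (s.nat a : ℝ)
  | .realCopy d a => s.setReal d (s.real a)
  | .realAdd d a b => s.setReal d (s.real a + s.real b)
  | .realSub d a b => s.setReal d (s.real a - s.real b)
  | .realMul d a b => s.setReal d (s.real a * s.real b)
  | .realDiv d a b => s.setReal d (s.real a / s.real b)
  | .realLoad d a => s.setReal d (s.real (s.nat a))
  | .realStore a b => s.setReal (s.nat a) (s.real b)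
  | .insertEdge a b =>
      if h : s.nat a < n ∧ s.nat b < n then
        { s with edges := insert s(⟨s.nat a, h.1⟩, ⟨s.nat b, h.2⟩) s.edges }
      else s
  | .eraseEdge a b =>
      if h : s.nat a < n ∧ s.nat b < n then
        { s with edges := s.edges.erase s(⟨s.nat a, h.1⟩, ⟨s.nat b, h.2⟩) }
      else s
  | .query d a b =>
      if h : s.nat a < n ∧ s.nat b < n then
        s.setReal d (proximity (addEdges G s.edges) α ⟨s.nat a, h.1⟩ ⟨s.nat b, h.2⟩)
      else s.setReal d 0

/-- The truth of a test. -/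
def Test.holds {n : ℕ} (G : SimpleGraph (Fin n)) (s : Store n) : Test → Prop
  | .natLt a b => s.nat a < s.nat b
  | .realLt a b => s.real a < s.real b
  | .isEdge a b => ∃ (ha : s.nat a < n) (hb : s.nat b < n), G.Adj ⟨s.nat a, ha⟩ ⟨s.nat b, hb⟩
  | .isAdded a b => ∃ (ha : s.nat a < n) (hb : s.nat b < n),
      s(⟨s.nat a, ha⟩, ⟨s.nat b, hb⟩) ∈ s.edges

/-- `Exec G α P s t s'`: the program `P`, on the input graph `G` with sampling probability `α`,
started in the state `s`, halts after exactly `t` steps in the state `s'`. -/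
inductive Exec {n : ℕ} (G : SimpleGraph (Fin n)) (α : ℝ) :
    Program → Store n → ℕ → Store n → Prop
  | instr (i : Instr) (s : Store n) : Exec G α (.instr i) s 1 (i.exec G α s)
  | seq {P Q : Program} {s s' s'' : Store n} {t t' : ℕ} :
      Exec G α P s t s' → Exec G α Q s' t' s'' → Exec G α (.seq P Q) s (t + t') s''
  | ite_true {c : Test} {P Q : Program} {s s' : Store n} {t : ℕ} :
      c.holds G s → Exec G α P s t s' → Exec G α (.ite c P Q) s (t + 1) s'
  | ite_false {c : Test} {P Q : Program} {s s' : Store n} {t : ℕ} :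
      ¬ c.holds G s → Exec G α Q s t s' → Exec G α (.ite c P Q) s (t + 1) s'
  | loop_false {c : Test} {P : Program} {s : Store n} :
      ¬ c.holds G s → Exec G α (.loop c P) s 1 s
  | loop_true {c : Test} {P : Program} {s s' s'' : Store n} {t t' : ℕ} :
      c.holds G s → Exec G α P s t s' → Exec G α (.loop c P) s' t' s'' →
      Exec G α (.loop c P) s (t + t' + 1) s''

end BroadcastImprovement

/-! Write `P u v` for the proximity in `G`. Let `F` be an optimal set of at most `k` edges and `X`
the set of its endpoints, so `X` has at most `2k` elements. If `u` and `v` are connected in the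
sample of `G + F` but not in that of `G`, then in `G` the vertex `u` reaches some `x ∈ X` and `v`
reaches some `y ∈ X`, in different clusters. Exploring the cluster of `u` and resampling everything
else shows that this has probability at most `P u x * P v y` (`sampleExp_disjoint_le`). A union
bound over at most `4k²` pairs shows that every pair `u, v` has either `P u v` or some `P u x * P v
y` at least `B = β* / (4k² + 1)` (`exists_hubs`). Conversely, a star from any centre to a set `S`
that serves all pairs in this sense has broadcast at least `α² B`, by Harris' inequality
(`le_broadcast_star`).

It remains to find a set `S` of size `O(k log n)` as good as the unknown `X`. This is done by
multiplicative weights. With `κ = min k n`, a greedy cover gives for the current vertex weights a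
set `S` such that, for every `u`, the vertices closer to `u` than all of `S` carry less than `1 /
(8κ)` of the total weight (`le_top_mass`, `exists_le_card_top`, `mass_lt_of_top`). For a pair that
`S` serves worst, the weight of every vertex closer to one of its ends than `S` is doubled. The
total weight grows by a factor of at most `1 + 1 / (4κ)`, but as long as `S` misses the level `B`,
some hub in `X` is doubled (`RoundInv.step`). After `8n²` rounds these two facts contradict each
other (`RoundInv.le`), so the best set met on the way reaches `B`. The method never needs to know
`B` or `X`.

The rest is implementation: a small language of arrays is compiled to the machine with a step bound
that depends on `n` only, and the rounds are written in that language. All oracle calls are made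
while `F` is still empty. -/

namespace BroadcastImprovement

/-! ### Random subsets: correlation and resampling. -/

section Sampling
variable {ι : Type*}

/-- The expectation of `f` on a random subset of `E` that keeps every element with probability `α`. -/
noncomputable def sampleExp (α : ℝ) (E : Finset ι) (f : Finset ι → ℝ) : ℝ :=
  ∑ A ∈ E.powerset, α ^ A.card * (1 - α) ^ (E.card - A.card) * f A

theorem sampleExp_mono {α : ℝ} (h0 : 0 ≤ α) (h1 : α ≤ 1) (E : Finset ι) {f g : Finset ι → ℝ}
    (h : ∀ A, f A ≤ g A) : sampleExp α E f ≤ sampleExp α E g :=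
  Finset.sum_le_sum fun A _ => mul_le_mul_of_nonneg_left (h A)
    (mul_nonneg (pow_nonneg h0 _) (pow_nonneg (sub_nonneg.2 h1) _))

theorem sampleExp_add (α : ℝ) (E : Finset ι) (f g : Finset ι → ℝ) :
    sampleExp α E (fun A => f A + g A) = sampleExp α E f + sampleExp α E g := by
  simp [sampleExp, mul_add, Finset.sum_add_distrib]

theorem sampleExp_sum (α : ℝ) (E : Finset ι) {κ : Type*} (s : Finset κ) (f : κ → Finset ι → ℝ) :
    sampleExp α E (fun A => ∑ i ∈ s, f i A) = ∑ i ∈ s, sampleExp α E (f i) := by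
  simp only [sampleExp, Finset.mul_sum]
  exact Finset.sum_comm

variable [DecidableEq ι]

theorem sampleExp_insert (α : ℝ) {E : Finset ι} {e : ι} (he : e ∉ E) (f : Finset ι → ℝ) :
    sampleExp α (insert e E) f =
      α * sampleExp α E (fun A => f (insert e A)) + (1 - α) * sampleExp α E f := by
  unfold sampleExp
  rw [Finset.sum_powerset_insert he, add_comm, Finset.mul_sum, Finset.mul_sum]
  congr 1
  · refine Finset.sum_congr rfl fun A hA => ?_
    have hA' := Finset.mem_powerset.1 hA
    rw [Finset.card_insert_of_notMem fun h => he (hA' h), Finset.card_insert_of_notMem he,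
      Nat.add_sub_add_right, pow_succ]
    ring
  · refine Finset.sum_congr rfl fun A hA => ?_
    have hA' := Finset.card_le_card (Finset.mem_powerset.1 hA)
    rw [Finset.card_insert_of_notMem he, Nat.sub_add_comm hA', pow_succ]
    ring

/-- The choices outside `E` sum out to weight one. This lets all graphs on the same vertices share
one sample of all pairs. -/
theorem sampleExp_inter (α : ℝ) {E E' : Finset ι} (h : E ⊆ E') (f : Finset ι → ℝ) :
    sampleExp α E' (fun A => f (A ∩ E)) = sampleExp α E f := by
  obtain ⟨D, rfl, hD⟩ : ∃ D, E' = D ∪ E ∧ Disjoint D E :=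
    ⟨E' \ E, by simp [h], Finset.sdiff_disjoint⟩
  clear h
  induction D using Finset.induction_on with
  | empty =>
    refine Finset.sum_congr (by simp) fun A hA => ?_
    simp only [Finset.empty_union, Finset.mem_powerset] at hA ⊢
    rw [Finset.inter_eq_left.2 hA]
  | insert e D he ih =>
    rw [Finset.disjoint_insert_left] at hD
    rw [Finset.insert_union, sampleExp_insert α (by simp [he, hD.1]), ← ih hD.2]
    simp only [Finset.insert_inter_of_notMem hD.1]
    ring

theorem sampleExp_const (α : ℝ) (E : Finset ι) (c : ℝ) : sampleExp α E (fun _ => c) = c := by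
  have := sampleExp_inter α (Finset.empty_subset E) (fun _ => c)
  rw [this]
  simp [sampleExp]

theorem sampleExp_mem (α : ℝ) {E : Finset ι} {e : ι} (he : e ∈ E) :
    sampleExp α E (fun A => if e ∈ A then 1 else 0) = α := by
  have := sampleExp_inter α (Finset.singleton_subset_iff.2 he) (fun A => if e ∈ A then (1 : ℝ) else 0)
  simp only [Finset.mem_inter, Finset.mem_singleton, and_true] at this
  rw [this, ← insert_empty_eq, sampleExp_insert α (Finset.notMem_empty e)]
  simp [sampleExp]

/-- Harris' inequality. -/
theorem sampleExp_mul_le [Fintype ι] {α : ℝ} (h0 : 0 ≤ α) (h1 : α ≤ 1) {f g : Finset ι → ℝ}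
    (hf0 : 0 ≤ f) (hg0 : 0 ≤ g) (hf : Monotone f) (hg : Monotone g) :
    sampleExp α Finset.univ f * sampleExp α Finset.univ g ≤
      sampleExp α Finset.univ (fun A => f A * g A) := by
  have key := fkg (α := Finset ι)
    (μ := fun A => α ^ A.card * (1 - α) ^ ((Finset.univ : Finset ι).card - A.card)) (f := f) (g := g)
    (fun A => mul_nonneg (pow_nonneg h0 _) (pow_nonneg (sub_nonneg.2 h1) _)) hf0 hg0 hf hg
    -- The weight depends only on the cardinality, which is modular, so the lattice condition of
    -- `fkg` holds with equality.
    (fun A B => by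
      have hc := Finset.card_inter_add_card_union A B
      have hA := Finset.card_le_univ A
      have hB := Finset.card_le_univ B
      have hU := Finset.card_le_univ (A ∪ B)
      have hI := Finset.card_le_univ (A ∩ B)
      apply le_of_eq
      simp only [Finset.inf_eq_inter, Finset.sup_eq_union]
      rw [mul_mul_mul_comm, ← pow_add, ← pow_add, mul_mul_mul_comm, ← pow_add, ← pow_add, hc]
      congr 2
      simp only [← Finset.card_univ] at hA hB hU hI
      omega)
  have one := sampleExp_const α (Finset.univ : Finset ι) 1
  simp only [sampleExp, Finset.powerset_univ, mul_one] at one ⊢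
  rwa [one, one_mul] at key

/-- Two independent samples: a weight preserving injection bounds a probability by a product. -/
theorem sampleExp_le_mul_of_swap [Fintype ι] {α : ℝ} (h0 : 0 ≤ α) (h1 : α ≤ 1)
    (Q Q₁ Q₂ : Finset ι → Prop) [DecidablePred Q] [DecidablePred Q₁] [DecidablePred Q₂]
    (T : Finset ι → Finset ι)
    (hT : ∀ A B, Q A → T ((A ∩ T A) ∪ (B \ T A)) = T A)
    (hQ₁ : ∀ A B, Q A → Q₁ ((A ∩ T A) ∪ (B \ T A)))
    (hQ₂ : ∀ A B, Q A → Q₂ ((B ∩ T A) ∪ (A \ T A))) :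
    sampleExp α Finset.univ (fun A => if Q A then 1 else 0) ≤
      sampleExp α Finset.univ (fun A => if Q₁ A then 1 else 0) *
      sampleExp α Finset.univ (fun A => if Q₂ A then 1 else 0) := by
  set μ : Finset ι → ℝ := fun A => α ^ A.card * (1 - α) ^ ((Finset.univ : Finset ι).card - A.card)
    with hμ
  have hμ0 : ∀ A, 0 ≤ μ A := fun A =>
    mul_nonneg (pow_nonneg h0 _) (pow_nonneg (sub_nonneg.2 h1) _)
  have one := sampleExp_const α (Finset.univ : Finset ι) 1
  have e : ∀ (R : Finset ι → Prop) [DecidablePred R],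
      sampleExp α Finset.univ (fun A => if R A then 1 else 0) = ∑ A with R A, μ A := by
    intro R _
    simp [sampleExp, Finset.sum_filter, hμ]
  have hsum : ∑ A, μ A = 1 := by simpa [sampleExp, hμ] using one
  rw [e, e, e, Finset.sum_mul_sum, ← mul_one (∑ A with Q A, μ A), ← hsum, Finset.sum_mul_sum,
    ← Finset.sum_product', ← Finset.sum_product']
  let φ : Finset ι × Finset ι → Finset ι × Finset ι := fun p =>
    ((p.1 ∩ T p.1) ∪ (p.2 \ T p.1), (p.2 ∩ T p.1) ∪ (p.1 \ T p.1))
  -- By `hT` the first component of the image determines `T A`; once `T A` is known, the exchange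
  -- outside it can be undone.
  have hφ : Set.InjOn φ (({A | Q A} : Finset (Finset ι)) ×ˢ (Finset.univ : Finset (Finset ι)) :
      Finset _) := by
    rintro ⟨A, B⟩ hA ⟨A', B'⟩ hA' h
    simp only [Finset.coe_product, Finset.coe_filter, Finset.mem_univ, true_and, Set.mem_prod,
      Set.mem_ofPred_eq, Finset.coe_univ, Set.mem_univ, and_true] at hA hA'
    simp only [φ, Prod.mk.injEq] at h
    have hTT : T A = T A' := by rw [← hT A B hA, ← hT A' B' hA', h.1]
    rw [hTT] at h
    obtain ⟨h1, h2⟩ := h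
    simp only [Finset.ext_iff, Finset.mem_union, Finset.mem_inter, Finset.mem_sdiff] at h1 h2
    ext a <;> grind
  refine le_trans (le_of_eq ?_) (Finset.sum_le_sum_of_subset_of_nonneg
    (s := (({A | Q A} : Finset (Finset ι)) ×ˢ (Finset.univ : Finset (Finset ι))).image φ) ?_ ?_)
  -- The exchange only moves elements between the two samples, so the total number of kept elements
  -- and the product of the weights are unchanged.
  · rw [Finset.sum_image hφ]
    refine Finset.sum_congr rfl fun p _ => ?_
    obtain ⟨A, B⟩ := p
    have c1 : ((A ∩ T A) ∪ (B \ T A)).card = (A ∩ T A).card + (B \ T A).card :=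
      Finset.card_union_of_disjoint (Finset.disjoint_left.2 (by grind))
    have c2 : ((B ∩ T A) ∪ (A \ T A)).card = (B ∩ T A).card + (A \ T A).card :=
      Finset.card_union_of_disjoint (Finset.disjoint_left.2 (by grind))
    have c3 := Finset.card_inter_add_card_sdiff A (T A)
    have c4 := Finset.card_inter_add_card_sdiff B (T A)
    have hA := Finset.card_le_univ A
    have hB := Finset.card_le_univ B
    have hU := Finset.card_le_univ ((A ∩ T A) ∪ (B \ T A))
    have hI := Finset.card_le_univ ((B ∩ T A) ∪ (A \ T A))
    simp only [hμ, φ]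
    rw [mul_mul_mul_comm, ← pow_add, ← pow_add, mul_mul_mul_comm, ← pow_add, ← pow_add]
    simp only [← Finset.card_univ] at hA hB hU hI
    congr 2 <;> omega
  · intro q hq
    obtain ⟨⟨A, B⟩, hA, rfl⟩ := Finset.mem_image.1 hq
    simp only [Finset.mem_product, Finset.mem_filter, Finset.mem_univ, true_and, and_true] at hA
    simp only [φ, Finset.mem_product, Finset.mem_filter, Finset.mem_univ, true_and]
    exact ⟨hQ₁ A B hA, hQ₂ A B hA⟩
  · intro q _ _
    exact mul_nonneg (hμ0 _) (hμ0 _)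

end Sampling

/-! ### Proximities and the hubs of an optimal solution. -/

section Proximity
variable {V : Type*}

/-- The random subgraph of `G` whose kept edges are those in `A`. -/
def sampled (G : SimpleGraph V) (A : Finset (Sym2 V)) : SimpleGraph V :=
  SimpleGraph.fromEdgeSet ((A : Set (Sym2 V)) ∩ G.edgeSet)

theorem sampled_adj {G : SimpleGraph V} {A : Finset (Sym2 V)} {a b : V} :
    (sampled G A).Adj a b ↔ s(a, b) ∈ A ∧ G.Adj a b := by
  simp only [sampled, SimpleGraph.fromEdgeSet_adj, Set.mem_inter_iff, Finset.mem_coe,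
    SimpleGraph.mem_edgeSet]
  exact ⟨fun h => h.1, fun h => ⟨h, h.2.ne⟩⟩

theorem sampled_mono {G H : SimpleGraph V} {A B : Finset (Sym2 V)} (hG : G ≤ H) (hA : A ⊆ B) :
    sampled G A ≤ sampled H B := fun a b h => by
  rw [sampled_adj] at h ⊢
  exact ⟨hA h.1, hG h.2⟩

theorem sampled_reachable_of_imp {G : SimpleGraph V} {A B : Finset (Sym2 V)} {u a : V}
    (h : ∀ e ∈ G.edgeSet, (∃ a ∈ e, (sampled G A).Reachable u a) → e ∈ A → e ∈ B)
    (ha : (sampled G A).Reachable u a) : (sampled G B).Reachable u a := by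
  rw [SimpleGraph.reachable_iff_reflTransGen] at ha
  induction ha with
  | refl => rfl
  | @tail b c hb hbc ih =>
    rw [← SimpleGraph.reachable_iff_reflTransGen] at hb
    refine ih.trans (SimpleGraph.Adj.reachable ?_)
    rw [sampled_adj] at hbc ⊢
    exact ⟨h _ hbc.2 ⟨b, by simp, hb⟩ hbc.1, hbc.2⟩

/-- The cluster of `u` is determined by the sampled edges that touch it. -/
theorem sampled_reachable_iff {G : SimpleGraph V} {A B : Finset (Sym2 V)} {u : V}
    (h : ∀ e : Sym2 V, (∃ a ∈ e, (sampled G A).Reachable u a) → (e ∈ A ↔ e ∈ B)) (a : V) :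
    (sampled G A).Reachable u a ↔ (sampled G B).Reachable u a := by
  refine ⟨sampled_reachable_of_imp fun e _ he => (h e he).1, fun ha => ?_⟩
  rw [SimpleGraph.reachable_iff_reflTransGen] at ha
  induction ha with
  | refl => rfl
  | @tail b c hb hbc ih =>
    refine ih.trans (SimpleGraph.Adj.reachable ?_)
    rw [sampled_adj] at hbc ⊢
    exact ⟨(h _ ⟨b, by simp, ih⟩).2 hbc.1, hbc.2⟩

/-- Follow a path from `u` up to its first step that is not in `G`: that step belongs to `F` and
starts in `X`. -/
theorem reachable_of_addEdges {G : SimpleGraph V} {F A : Finset (Sym2 V)} {X : Finset V}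
    (hX : ∀ e ∈ F, ∀ a ∈ e, a ∈ X) {u v : V} (h : (sampled (addEdges G F) A).Reachable u v) :
    (sampled G A).Reachable u v ∨ ∃ x ∈ X, (sampled G A).Reachable u x := by
  rw [SimpleGraph.reachable_iff_reflTransGen] at h
  induction h using Relation.ReflTransGen.head_induction_on with
  | refl => exact Or.inl (SimpleGraph.Reachable.refl _)
  | @head a b hab hb ih =>
    rw [sampled_adj, addEdges, SimpleGraph.sup_adj, SimpleGraph.fromEdgeSet_adj] at hab
    rcases hab.2 with hG | hF
    · have hr : (sampled G A).Reachable a b := (sampled_adj.2 ⟨hab.1, hG⟩).reachable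
      exact ih.imp hr.trans fun ⟨x, hx, hx'⟩ => ⟨x, hx, hr.trans hx'⟩
    · exact Or.inr ⟨a, hX _ hF.1 a (by simp), SimpleGraph.Reachable.refl _⟩

variable [Fintype V]

open Classical in
theorem proximity_eq_sampleExp (G : SimpleGraph V) (α : ℝ) (u v : V) :
    proximity G α u v =
      sampleExp α Finset.univ (fun A => if (sampled G A).Reachable u v then 1 else 0) := by
  have := sampleExp_inter α (Finset.subset_univ G.edgeFinset) (fun A : Finset (Sym2 V) =>
    if (SimpleGraph.fromEdgeSet (A : Set (Sym2 V))).Reachable u v then (1 : ℝ) else 0)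
  simp only [Finset.coe_inter, SimpleGraph.coe_edgeFinset] at this
  refine Eq.trans ?_ (this.symm.trans ?_)
  · rw [proximity, sampleExp]
    exact Finset.sum_congr rfl fun A _ => by split_ifs <;> simp
  · simp only [sampled]
    congr 1
    funext A
    congr

theorem proximity_nonneg {α : ℝ} (h0 : 0 ≤ α) (h1 : α ≤ 1) (G : SimpleGraph V) (u v : V) : 0 ≤ proximity G α u v := by
  classical
  rw [proximity_eq_sampleExp]
  refine (sampleExp_const α (Finset.univ : Finset (Sym2 V)) 0).symm.le.trans
    (sampleExp_mono h0 h1 _ fun A => ?_)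
  split_ifs <;> norm_num

theorem proximity_le_one {α : ℝ} (h0 : 0 ≤ α) (h1 : α ≤ 1) (G : SimpleGraph V) (u v : V) : proximity G α u v ≤ 1 := by
  classical
  rw [proximity_eq_sampleExp]
  refine (sampleExp_mono h0 h1 _ fun A => ?_).trans
    (sampleExp_const α (Finset.univ : Finset (Sym2 V)) 1).le
  split_ifs <;> norm_num

theorem proximity_mono {α : ℝ} (h0 : 0 ≤ α) (h1 : α ≤ 1) {G H : SimpleGraph V} (hGH : G ≤ H) (u v : V) :
    proximity G α u v ≤ proximity H α u v := by
  classical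
  rw [proximity_eq_sampleExp, proximity_eq_sampleExp]
  refine sampleExp_mono h0 h1 _ fun A => ?_
  split_ifs with h h'
  · rfl
  · exact absurd (h.mono (sampled_mono hGH subset_rfl)) h'
  · norm_num
  · rfl

/-- Connection events are increasing, hence positively correlated by Harris' inequality, and
together they connect `u` with `w`. This is the triangle inequality in multiplicative form. -/
theorem proximity_mul_le {α : ℝ} (h0 : 0 ≤ α) (h1 : α ≤ 1) (G : SimpleGraph V) (u v w : V) :
    proximity G α u v * proximity G α v w ≤ proximity G α u w := by
  classical
  simp only [proximity_eq_sampleExp]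
  have hm : ∀ a b : V, Monotone fun A : Finset (Sym2 V) =>
      if (sampled G A).Reachable a b then (1 : ℝ) else 0 := by
    intro a b A B hAB
    dsimp only
    split_ifs with h h'
    · rfl
    · exact absurd (h.mono (sampled_mono le_rfl hAB)) h'
    · norm_num
    · rfl
  have hp : ∀ a b : V, (0 : Finset (Sym2 V) → ℝ) ≤ fun A : Finset (Sym2 V) =>
      if (sampled G A).Reachable a b then (1 : ℝ) else 0 := by
    intro a b A
    dsimp only
    split_ifs <;> simp
  refine (sampleExp_mul_le h0 h1 (hp u v) (hp v w) (hm u v) (hm v w)).trans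
    (sampleExp_mono h0 h1 _ fun A => ?_)
  split_ifs with h h' h'' <;> norm_num
  exact h'' (h.trans h')

theorem le_proximity_of_adj {α : ℝ} (h0 : 0 ≤ α) (h1 : α ≤ 1) {G : SimpleGraph V} {u v : V} (h : G.Adj u v) :
    α ≤ proximity G α u v := by
  classical
  rw [proximity_eq_sampleExp]
  refine (sampleExp_mem α (Finset.mem_univ s(u, v))).symm.le.trans ?_
  refine sampleExp_mono h0 h1 _ fun A => ?_
  split_ifs with h' h''
  · rfl
  · exact absurd (sampled_adj.2 ⟨h', h⟩).reachable h''
  · norm_num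
  · rfl

theorem proximity_self {α : ℝ} (G : SimpleGraph V) (u : V) : proximity G α u u = 1 := by
  classical
  rw [proximity_eq_sampleExp]
  simp [sampleExp_const]

theorem proximity_comm {α : ℝ} (G : SimpleGraph V) (u v : V) :
    proximity G α u v = proximity G α v u := by
  classical
  simp only [proximity_eq_sampleExp, SimpleGraph.reachable_comm (u := u)]

open Classical in
/-- Being joined to `x` and `y` by different clusters is at most as likely as under independence. -/
theorem sampleExp_disjoint_le {α : ℝ} (h0 : 0 ≤ α) (h1 : α ≤ 1) (G : SimpleGraph V) (u v x y : V) :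
    sampleExp α Finset.univ (fun A : Finset (Sym2 V) =>
      if (sampled G A).Reachable u x ∧ (sampled G A).Reachable v y ∧ ¬ (sampled G A).Reachable u v
      then 1 else 0) ≤ proximity G α u x * proximity G α v y := by
  rw [proximity_eq_sampleExp, proximity_eq_sampleExp]
  -- The pairs that touch the cluster of `u`: they determine this cluster, and everything else can
  -- be exchanged with a second sample.
  let T : Finset (Sym2 V) → Finset (Sym2 V) := fun A =>
    {e | ∃ a ∈ e, (sampled G A).Reachable u a}
  have hT : ∀ A e, e ∈ T A ↔ ∃ a ∈ e, (sampled G A).Reachable u a := by simp [T]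
  have hc : ∀ A B a, (sampled G A).Reachable u a ↔
      (sampled G ((A ∩ T A) ∪ (B \ T A))).Reachable u a := fun A B a =>
    sampled_reachable_iff (fun e he => by
      have := (hT A e).2 he
      simp [this]) a
  refine sampleExp_le_mul_of_swap h0 h1 _ _ _ T ?_ ?_ ?_
  · intro A B _
    ext e
    rw [hT, hT]
    simp only [← hc A B]
  · exact fun A B hQ => (hc A B x).1 hQ.1
  -- The cluster of `v` is disjoint from that of `u`, so its kept edges lie outside `T A` and
  -- survive in the second sample.
  · rintro A B ⟨-, hvy, huv⟩
    refine sampled_reachable_of_imp (fun e heG he heA => ?_) hvy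
    obtain ⟨a, ha, hva⟩ := he
    have heT : e ∉ T A := by
      intro heT
      obtain ⟨b, hb, hub⟩ := (hT A e).1 heT
      apply huv
      by_cases hab : a = b
      · subst hab
        exact hub.trans hva.symm
      · have he : e = s(a, b) := (Sym2.mem_and_mem_iff hab).1 ⟨ha, hb⟩
        subst he
        exact hub.trans ((sampled_adj.2 ⟨heA, heG⟩).reachable.symm.trans hva.symm)
    simp [heA, heT]

-- If `u` and `v` are joined only with the help of `F`, then `reachable_of_addEdges` from both sides
-- joins each of them to `X` within `G`, in different clusters. The rest is a union bound.
open Classical in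
theorem proximity_addEdges_le {α : ℝ} (h0 : 0 ≤ α) (h1 : α ≤ 1) (G : SimpleGraph V) {F : Finset (Sym2 V)} {X : Finset V}
    (hX : ∀ e ∈ F, ∀ a ∈ e, a ∈ X) (u v : V) :
    proximity (addEdges G F) α u v ≤
      proximity G α u v + ∑ x ∈ X, ∑ y ∈ X, proximity G α u x * proximity G α v y := by
  refine le_trans ?_ (add_le_add_right (Finset.sum_le_sum fun x _ => Finset.sum_le_sum fun y _ =>
    sampleExp_disjoint_le h0 h1 G u v x y) _)
  simp only [← sampleExp_sum]
  rw [proximity_eq_sampleExp, proximity_eq_sampleExp, ← sampleExp_add]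
  refine sampleExp_mono h0 h1 _ fun A => ?_
  have hn : ∀ x ∈ X, ∀ y ∈ X, (0 : ℝ) ≤ if (sampled G A).Reachable u x ∧
      (sampled G A).Reachable v y ∧ ¬ (sampled G A).Reachable u v then 1 else 0 := by
    intro x _ y _
    split_ifs <;> norm_num
  by_cases huv : (sampled G A).Reachable u v
  · rw [if_pos huv]
    have := Finset.sum_nonneg fun x hx => Finset.sum_nonneg (hn x hx)
    split_ifs <;> linarith
  · rw [if_neg huv, zero_add]
    split_ifs with h
    · obtain ⟨x, hx, hux⟩ := (reachable_of_addEdges hX h).resolve_left huv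
      obtain ⟨y, hy, hvy⟩ := (reachable_of_addEdges hX h.symm).resolve_left fun h => huv h.symm
      refine le_trans ?_ (Finset.single_le_sum
        (fun x hx => Finset.sum_nonneg (hn x hx)) hx)
      refine le_trans ?_ (Finset.single_le_sum (hn x hx) hy)
      rw [if_pos ⟨hux, hvy, huv⟩]
    · exact Finset.sum_nonneg fun x hx => Finset.sum_nonneg (hn x hx)

theorem broadcast_le (G : SimpleGraph V) (α : ℝ) (u v : V) : broadcast G α ≤ proximity G α u v :=
  ciInf_le (Set.finite_range fun p : V × V => proximity G α p.1 p.2).bddBelow (u, v)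

theorem broadcast_nonneg {α : ℝ} (h0 : 0 ≤ α) (h1 : α ≤ 1) (G : SimpleGraph V) :
    0 ≤ broadcast G α :=
  Real.iInf_nonneg fun _ => proximity_nonneg h0 h1 _ _ _

theorem optBroadcast_nonneg {α : ℝ} (h0 : 0 ≤ α) (h1 : α ≤ 1) (G : SimpleGraph V) (k : ℕ) :
    0 ≤ optBroadcast G α k := by
  obtain ⟨F, hF⟩ := candidates_nonempty G k
  exact (broadcast_nonneg h0 h1 _).trans (Finset.le_sup' (fun F => broadcast (addEdges G F) α) hF)

theorem optBroadcast_le_one {α : ℝ} (h0 : 0 ≤ α) (h1 : α ≤ 1) [Nonempty V] (G : SimpleGraph V)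
    (k : ℕ) : optBroadcast G α k ≤ 1 := by
  refine Finset.sup'_le _ _ fun F _ => ?_
  obtain ⟨v⟩ := ‹Nonempty V›
  exact (broadcast_le _ α v v).trans (proximity_le_one h0 h1 _ _ _)

/-- If adding `k` edges can raise the broadcast to `β`, then at most `2k` vertices serve every pair of
vertices that is not close already. -/
theorem exists_hubs {α : ℝ} (h0 : 0 ≤ α) (h1 : α ≤ 1) (G : SimpleGraph V) (k : ℕ) :
    ∃ X : Finset V, X.card ≤ 2 * k ∧ ∀ u v,
      optBroadcast G α k / (4 * (k : ℝ) ^ 2 + 1) ≤ proximity G α u v ∨ ∃ x ∈ X, ∃ y ∈ X,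
        optBroadcast G α k / (4 * (k : ℝ) ^ 2 + 1) ≤ proximity G α u x * proximity G α v y := by
  classical
  obtain ⟨F, hF, hF'⟩ := Finset.exists_mem_eq_sup' (candidates_nonempty G k)
    (fun F => broadcast (addEdges G F) α)
  change optBroadcast G α k = _ at hF'
  set b := optBroadcast G α k with hb
  have hb0 : 0 ≤ b := optBroadcast_nonneg h0 h1 G k
  have hcard : (F.biUnion Sym2.toFinset).card ≤ 2 * k := by
    have hk : F.card ≤ k := (Finset.mem_filter.1 hF).2
    refine (Finset.card_biUnion_le_card_mul F _ 2 fun e _ => ?_).trans (by omega)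
    rw [Sym2.card_toFinset]
    split_ifs <;> omega
  refine ⟨F.biUnion Sym2.toFinset, hcard, fun u v => ?_⟩
  by_contra! hcon
  obtain ⟨hc1, hc2⟩ := hcon
  set B := b / (4 * (k : ℝ) ^ 2 + 1) with hB
  have hB0 : 0 ≤ B := by positivity
  have h := proximity_addEdges_le h0 h1 G (F := F) (X := F.biUnion Sym2.toFinset)
    (fun e he a ha => Finset.mem_biUnion.2 ⟨e, he, Sym2.mem_toFinset.2 ha⟩) u v
  -- If all options were below `B`, the direct term and the at most `4k²` products would add up to
  -- less than `(4k² + 1) B = b`.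
  have hsum : ∑ x ∈ F.biUnion Sym2.toFinset, ∑ y ∈ F.biUnion Sym2.toFinset,
      proximity G α u x * proximity G α v y ≤ 4 * (k : ℝ) ^ 2 * B := by
    refine (Finset.sum_le_sum fun x hx => Finset.sum_le_sum fun y hy =>
      (hc2 x hx y hy).le).trans ?_
    simp only [Finset.sum_const, nsmul_eq_mul]
    rw [← mul_assoc]
    refine mul_le_mul_of_nonneg_right ?_ hB0
    have : ((F.biUnion Sym2.toFinset).card : ℝ) ≤ 2 * k := by exact_mod_cast hcard
    nlinarith
  have h2 := broadcast_le (addEdges G F) α u v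
  have h3 : b = B * (4 * (k : ℝ) ^ 2 + 1) := by
    rw [hB]
    field_simp
  linarith

/-- Joining a centre to all hubs serves all pairs of vertices that the hubs serve. -/
theorem le_broadcast_star {α : ℝ} (h0 : 0 ≤ α) (h1 : α ≤ 1) {G : SimpleGraph V} {c : V}
    {S : Set V} {F : Finset (Sym2 V)} (hF : ∀ x ∈ S, x = c ∨ (addEdges G F).Adj c x) {B : ℝ}
    (hB0 : 0 ≤ B)
    (hB : ∀ u v, B ≤ proximity G α u v ∨ ∃ x ∈ S, ∃ y ∈ S,
      B ≤ proximity G α u x * proximity G α v y) :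
    α ^ 2 * B ≤ broadcast (addEdges G F) α := by
  have : Nonempty (V × V) := ⟨(c, c)⟩
  refine le_ciInf fun ⟨u, v⟩ => ?_
  have hG : G ≤ addEdges G F := le_sup_left
  set H := addEdges G F
  have hα : α ^ 2 * B ≤ B := mul_le_of_le_one_left hB0 (pow_le_one₀ h0 h1)
  have hc : ∀ x ∈ S, α ≤ proximity H α c x := by
    intro x hx
    rcases hF x hx with rfl | h
    · rwa [proximity_self]
    · exact le_proximity_of_adj h0 h1 h
  rcases hB u v with h | ⟨x, hx, y, hy, h⟩
  · exact hα.trans (h.trans (proximity_mono h0 h1 hG u v))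
  -- Each end of the pair pays one factor `α` for the star edge from its hub to the centre.
  · have e1 : proximity G α u x * α ≤ proximity H α u c := by
      refine le_trans ?_ (proximity_mul_le h0 h1 H u x c)
      rw [proximity_comm H x c]
      exact mul_le_mul (proximity_mono h0 h1 hG u x) (hc x hx) h0 (proximity_nonneg h0 h1 _ _ _)
    have e2 : proximity G α v y * α ≤ proximity H α c v := by
      rw [proximity_comm H c v]
      refine le_trans ?_ (proximity_mul_le h0 h1 H v y c)
      rw [proximity_comm H y c]
      exact mul_le_mul (proximity_mono h0 h1 hG v y) (hc y hy) h0 (proximity_nonneg h0 h1 _ _ _)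
    refine le_trans ?_ (proximity_mul_le h0 h1 H u c v)
    refine le_trans ?_ (mul_le_mul e1 e2 (mul_nonneg (proximity_nonneg h0 h1 _ _ _) h0)
      (proximity_nonneg h0 h1 _ _ _))
    nlinarith [mul_le_mul_of_nonneg_left h (sq_nonneg α)]

end Proximity
-- Runs of programs with a bound on the steps.
section Runs
variable {n : ℕ} {G : SimpleGraph (Fin n)} {α : ℝ}

/-- `P` takes the state `s` to the state `s'` in at most `T` steps. -/
def Runs (G : SimpleGraph (Fin n)) (α : ℝ) (P : Program) (T : ℕ) (s s' : Store n) : Prop :=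
  ∃ t ≤ T, Exec G α P s t s'

theorem Runs.instr (i : Instr) (s : Store n) : Runs G α (.instr i) 1 s (i.exec G α s) :=
  ⟨1, le_rfl, .instr i s⟩

theorem Runs.seq {P Q : Program} {T T' : ℕ} {s s' s'' : Store n} (h : Runs G α P T s s')
    (h' : Runs G α Q T' s' s'') : Runs G α (.seq P Q) (T + T') s s'' := by
  obtain ⟨t, ht, h⟩ := h
  obtain ⟨t', ht', h'⟩ := h'
  exact ⟨t + t', by omega, .seq h h'⟩

theorem Runs.ite_true {c : Test} {P Q : Program} {T : ℕ} {s s' : Store n} (hc : c.holds G s)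
    (h : Runs G α P T s s') : Runs G α (.ite c P Q) (T + 1) s s' := by
  obtain ⟨t, ht, h⟩ := h
  exact ⟨t + 1, by omega, .ite_true hc h⟩

theorem Runs.ite_false {c : Test} {P Q : Program} {T : ℕ} {s s' : Store n} (hc : ¬ c.holds G s)
    (h : Runs G α Q T s s') : Runs G α (.ite c P Q) (T + 1) s s' := by
  obtain ⟨t, ht, h⟩ := h
  exact ⟨t + 1, by omega, .ite_false hc h⟩

theorem Runs.mono {P : Program} {T T' : ℕ} {s s' : Store n} (h : Runs G α P T s s')
    (hT : T ≤ T') : Runs G α P T' s s' := by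
  obtain ⟨t, ht, h⟩ := h
  exact ⟨t, ht.trans hT, h⟩

/-- `for N[c] < n do P` -/
def forRange (c : ℕ) (P : Program) : Program :=
  .seq (.instr (.natConst c 0)) (.loop (.natLt c 0)
    (.seq P (.seq (.instr (.natConst 2 1)) (.instr (.natAdd c c 2)))))

/-- The invariant rule for counted loops. A pass costs `T + 3`: the test, loading `1` into the
scratch cell `N[2]`, and the increment. The `2` pays for the initialisation and the last test. -/
theorem forRange_runs {c : ℕ} (hc0 : c ≠ 0) (hc2 : c ≠ 2) {P : Program} {T : ℕ}
    (I : ℕ → Store n → Prop) {s : Store n} (hs : s.nat 0 = n) (h0 : I 0 (s.setNat c 0))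
    (hstep : ∀ i < n, ∀ s, s.nat 0 = n → s.nat c = i → I i s →
      ∃ s', Runs G α P T s s' ∧ s'.nat 0 = n ∧ s'.nat c = i ∧
        I (i + 1) ((s'.setNat 2 1).setNat c (i + 1))) :
    ∃ s', Runs G α (forRange c P) (2 + n * (T + 3)) s s' ∧ s'.nat 0 = n ∧ I n s' := by
  have key : ∀ m i s, i + m = n → s.nat 0 = n → s.nat c = i → I i s →
      ∃ s', Runs G α (.loop (.natLt c 0)
        (.seq P (.seq (.instr (.natConst 2 1)) (.instr (.natAdd c c 2))))) (1 + m * (T + 3)) s s' ∧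
        s'.nat 0 = n ∧ I n s' := by
    intro m
    induction m with
    | zero =>
      intro i s hi hn hc hI
      obtain rfl : i = n := by omega
      exact ⟨s, ⟨1, by omega, .loop_false (by simp [Test.holds, hc, hn])⟩, hn, hI⟩
    | succ m ih =>
      intro i s hi hn hc hI
      obtain ⟨s', ⟨t', ht', hr⟩, hn', hc', hI'⟩ := hstep i (by omega) s hn hc hI
      obtain ⟨s'', ⟨t'', ht'', hr''⟩, hn'', hI''⟩ :=
        ih (i + 1) ((s'.setNat 2 1).setNat c (i + 1)) (by omega)
          (by simp [Store.setNat, Function.update_of_ne hc0.symm, hn']) (by simp [Store.setNat]) hI'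
      refine ⟨s'', ⟨t' + (1 + 1) + t'' + 1, ?_, .loop_true ?_ (.seq hr (.seq (.instr _ _)
        (.instr _ _))) ?_⟩, hn'', hI''⟩
      · rw [Nat.add_mul]
        omega
      · simp only [Test.holds]
        omega
      · convert hr'' using 1
        simp [Instr.exec, Store.setNat, Function.update_of_ne hc2, hc']
  obtain ⟨s', hr, hn', hI'⟩ := key n 0 (s.setNat c 0) (by omega)
    (by simp [Store.setNat, Function.update_of_ne hc0.symm, hs]) (by simp [Store.setNat]) h0
  exact ⟨s', ((Runs.instr (.natConst c 0) s).seq hr).mono (by omega), hn', hI'⟩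

end Runs

/-! A language of arrays of length `n` of real numbers. -/

/-- Binary operations; a comparison has the value `0` or `1`. -/
inductive Op : Type
  | add | sub | mul | lt | max

/-- The value of an operation. -/
noncomputable def Op.apply : Op → ℝ → ℝ → ℝ
  | .add, x, y => x + y
  | .sub, x, y => x - y
  | .mul, x, y => x * y
  | .lt, x, y => if x < y then 1 else 0
  | .max, x, y => if x < y then y else x

/-- `R[d] := R[a] o R[b]` -/
def Op.compile (d a b : ℕ) : Op → Program
  | .add => .instr (.realAdd d a b)
  | .sub => .instr (.realSub d a b)
  | .mul => .instr (.realMul d a b)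
  | .lt => .ite (.realLt a b) (.instr (.realConst d 1)) (.instr (.realConst d 0))
  | .max => .ite (.realLt a b) (.instr (.realCopy d b)) (.instr (.realCopy d a))

theorem Op.compile_runs {n : ℕ} (G : SimpleGraph (Fin n)) (α : ℝ) (d a b : ℕ) (o : Op)
    (s : Store n) :
    Runs G α (o.compile d a b) 2 s (s.setReal d (o.apply (s.real a) (s.real b))) := by
  cases o with
  | add => exact (Runs.instr _ s).mono (by norm_num)
  | sub => exact (Runs.instr _ s).mono (by norm_num)
  | mul => exact (Runs.instr _ s).mono (by norm_num)
  | lt =>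
    by_cases h : s.real a < s.real b
    · simpa [Op.apply, Op.compile, h, Instr.exec] using Runs.ite_true (P := .instr (.realConst d 1))
        (Q := .instr (.realConst d 0)) (c := .realLt a b) h (Runs.instr (G := G) (α := α) _ s)
    · simpa [Op.apply, Op.compile, h, Instr.exec] using Runs.ite_false (P := .instr (.realConst d 1))
        (Q := .instr (.realConst d 0)) (c := .realLt a b) h (Runs.instr (G := G) (α := α) _ s)
  | max =>
    by_cases h : s.real a < s.real b
    · simpa [Op.apply, Op.compile, h, Instr.exec] using Runs.ite_true (P := .instr (.realCopy d b))
        (Q := .instr (.realCopy d a)) (c := .realLt a b) h (Runs.instr (G := G) (α := α) _ s)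
    · simpa [Op.apply, Op.compile, h, Instr.exec] using Runs.ite_false (P := .instr (.realCopy d b))
        (Q := .instr (.realCopy d a)) (c := .realLt a b) h (Runs.instr (G := G) (α := α) _ s)

/-- `0 o f 0 o f 1 o … o f (m - 1)` -/
noncomputable def Op.foldRange (o : Op) (f : ℕ → ℝ) : ℕ → ℝ
  | 0 => 0
  | m + 1 => o.apply (o.foldRange f m) (f m)

theorem Op.foldRange_congr (o : Op) {f g : ℕ → ℝ} {m : ℕ} (h : ∀ i < m, f i = g i) :
    o.foldRange f m = o.foldRange g m := by
  induction m with
  | zero => rfl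
  | succ m ih => simp only [foldRange, ih fun i hi => h i (by omega), h m (by omega)]

/-- Expressions in the variables `0, …, d - 1`, which stand for numbers below `n`; `fold` binds the
variable `d`. -/
inductive Ex : Type
  | const (c : ℕ)
  | order
  | budget
  | idx (v : ℕ)
  | cell (j : Fin 16) (v : ℕ)
  | prox (u v : ℕ)
  | op (o : Op) (a b : Ex)
  | fold (o : Op) (a : Ex)

namespace Ex

/-- The variables of the expression are below `d`. -/
def Scoped : ℕ → Ex → Prop
  | _, const _ => True
  | _, order => True
  | _, budget => True
  | d, idx v => v < d
  | d, cell _ v => v < d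
  | d, prox u v => u < d ∧ v < d
  | d, op _ a b => a.Scoped d ∧ b.Scoped d
  | d, fold _ a => a.Scoped (d + 1)

/-- The expression does not read the array `j`. -/
def Avoids (j : Fin 16) : Ex → Prop
  | cell j' _ => j' ≠ j
  | op _ a b => a.Avoids j ∧ b.Avoids j
  | fold _ a => a.Avoids j
  | _ => True

/-- The value, with the proximities `P`, the arrays `σ` and the values `ρ` of the variables. -/
noncomputable def eval (P : ℕ → ℕ → ℝ) (n k : ℕ) (σ : Fin 16 → ℕ → ℝ) : ℕ → (ℕ → ℕ) → Ex → ℝ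
  | _, _, const c => c
  | _, _, order => n
  | _, _, budget => k
  | _, ρ, idx v => ρ v
  | _, ρ, cell j v => σ j (ρ v)
  | _, ρ, prox u v => P (ρ u) (ρ v)
  | d, ρ, op o a b => o.apply (a.eval P n k σ d ρ) (b.eval P n k σ d ρ)
  | d, ρ, fold o a => o.foldRange (fun i => a.eval P n k σ (d + 1) (Function.update ρ d i)) n

/-- The alternative in `hj` covers two uses: an array that is being overwritten while the expression
is evaluated entry by entry, and mere changes of the variables not in scope. -/
theorem eval_congr {P : ℕ → ℕ → ℝ} {n k : ℕ} {σ σ' : Fin 16 → ℕ → ℝ} {j : Fin 16}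
    (hσ : ∀ j', j' ≠ j → σ j' = σ' j') (e : Ex) {d : ℕ} {ρ ρ' : ℕ → ℕ} (he : e.Scoped d)
    (hj : e.Avoids j ∨ σ = σ') (h : ∀ v < d, ρ v = ρ' v) :
    e.eval P n k σ d ρ = e.eval P n k σ' d ρ' := by
  induction e generalizing d ρ ρ' with
  | const | order | budget => rfl
  | idx v => simp [eval, h v he]
  | cell j' v =>
    simp only [eval, h v he]
    rcases hj with hj | rfl
    · rw [hσ j' hj]
    · rfl
  | prox u v => simp [eval, h u he.1, h v he.2]
  | op o a b iha ihb =>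
    simp only [eval]
    rw [iha he.1 (hj.imp_left And.left) h, ihb he.2 (hj.imp_left And.right) h]
  | fold o a ih =>
    refine Op.foldRange_congr o fun i _ => ih he hj fun v hv => ?_
    rcases eq_or_ne v d with rfl | hvd
    · simp
    · simp [Function.update_of_ne hvd, h v (by omega)]

/-- The number of real registers that the evaluation takes. -/
def regs : Ex → ℕ
  | op _ a b => max a.regs (b.regs + 1) + 1
  | fold _ a => a.regs + 2
  | _ => 1

/-- `N[2] :=` the address of the entry `N[2v + 5]` of the array `j` -/
def address (D : ℕ) (j : Fin 16) (v : ℕ) : Program :=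
  -- The machine cannot multiply natural numbers; four doublings give the stride 16 of the
  -- interleaved arrays.
  .seq (.instr (.natCopy 2 (2 * v + 5))) <| .seq (.instr (.natAdd 2 2 2)) <|
  .seq (.instr (.natAdd 2 2 2)) <| .seq (.instr (.natAdd 2 2 2)) <|
  .seq (.instr (.natAdd 2 2 2)) <| .seq (.instr (.natConst 3 (D + j))) (.instr (.natAdd 2 2 3))

/-- `R[r] :=` the value of the expression, with the variable `v` in `N[2v + 5]` -/
def compile (D : ℕ) : ℕ → ℕ → Ex → Program
  | _, r, const c => .instr (.realConst r c)
  | _, r, order => .instr (.realOfNat r 0)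
  | _, r, budget => .instr (.realOfNat r 1)
  | _, r, idx v => .instr (.realOfNat r (2 * v + 5))
  | _, r, cell j v => .seq (address D j v) (.instr (.realLoad r 2))
  | _, r, prox u v => .instr (.query r (2 * u + 5) (2 * v + 5))
  | d, r, op o a b => .seq (a.compile D d r) (.seq (b.compile D d (r + 1)) (o.compile r r (r + 1)))
  | d, r, fold o a => .seq (.instr (.realConst r 0))
      (forRange (2 * d + 5) (.seq (a.compile D (d + 1) (r + 1)) (o.compile r r (r + 1))))

/-- A bound for the number of steps of the evaluation. -/
noncomputable def time : Ex → Polynomial ℕ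
  | cell _ _ => 8
  | op _ a b => a.time + b.time + 2
  | fold _ a => 3 + Polynomial.X * (a.time + 5)
  | _ => 1

end Ex

/-! ### Correctness of compiled expressions. -/

/-- The two states agree but for the numbers in scratch registers and in variables `≥ d`, and the
real registers from `r` to `D - 1`. -/
structure SameBelow {n : ℕ} (d r D : ℕ) (s s' : Store n) : Prop where
  edges : s'.edges = s.edges
  nat : ∀ a, a ≠ 2 → a ≠ 3 → (a % 2 = 1 → a < 2 * d + 5) → s'.nat a = s.nat a
  real : ∀ a, a < r ∨ D ≤ a → s'.real a = s.real a

namespace SameBelow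
variable {n d r D : ℕ} {s s' s'' : Store n}

theorem trans (h : SameBelow d r D s s') (h' : SameBelow d r D s' s'') : SameBelow d r D s s'' where
  edges := h'.edges.trans h.edges
  nat a h1 h2 h3 := (h'.nat a h1 h2 h3).trans (h.nat a h1 h2 h3)
  real a h1 := (h'.real a h1).trans (h.real a h1)

theorem weaken {d' r' : ℕ} (h : SameBelow d' r' D s s') (hd : d ≤ d') (hr : r ≤ r') :
    SameBelow d r D s s' where
  edges := h.edges
  nat a h1 h2 h3 := h.nat a h1 h2 fun h => by have := h3 h; omega
  real a h1 := h.real a (by omega)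

theorem setReal (s : Store n) (d : ℕ) {r a : ℕ} (h1 : r ≤ a) (h2 : a < D) (x : ℝ) :
    SameBelow d r D s (s.setReal a x) where
  edges := rfl
  nat _ _ _ _ := rfl
  real b hb := by
    have : b ≠ a := by omega
    simp [Store.setReal, Function.update_of_ne this]

end SameBelow

/-- The array `j` starts at the address `D + j` and takes every sixteenth register. -/
def cells {n : ℕ} (D : ℕ) (s : Store n) (j : Fin 16) (x : ℕ) : ℝ := s.real (D + j + 16 * x)

theorem SameBelow.cells_eq {n d r D : ℕ} {s s' : Store n} (h : SameBelow d r D s s') :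
    cells D s' = cells D s := by
  ext j x
  exact h.real _ (Or.inr (by omega))

/-- The values of the variables. -/
def vars {n : ℕ} (s : Store n) (v : ℕ) : ℕ := s.nat (2 * v + 5)

theorem SameBelow.vars_eq {n d r D : ℕ} {s s' : Store n} (h : SameBelow d r D s s') :
    ∀ v < d, vars s' v = vars s v := fun v hv => h.nat _ (by omega) (by omega) (by omega)

/-- Proximities as a function of numbers. -/
noncomputable def natProximity {n : ℕ} (G : SimpleGraph (Fin n)) (α : ℝ) (i j : ℕ) : ℝ :=
  if h : i < n ∧ j < n then proximity G α ⟨i, h.1⟩ ⟨j, h.2⟩ else 0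

theorem Ex.address_runs {n : ℕ} (G : SimpleGraph (Fin n)) (α : ℝ) (D : ℕ) (j : Fin 16) (v d r : ℕ)
    (s : Store n) :
    ∃ s', Runs G α (address D j v) 7 s s' ∧ SameBelow d r D s s' ∧ s'.real = s.real ∧
      s'.nat 2 = D + j + 16 * vars s v := by
  refine ⟨_, (Runs.instr _ _).seq <| (Runs.instr _ _).seq <| (Runs.instr _ _).seq <|
    (Runs.instr _ _).seq <| (Runs.instr _ _).seq <| (Runs.instr _ _).seq (Runs.instr _ _),
    ⟨rfl, ?_, fun _ _ => rfl⟩, rfl, ?_⟩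
  · intro a h2 h3 _
    simp [Instr.exec, Store.setNat, Function.update_of_ne h2, Function.update_of_ne h3]
  · simp [Instr.exec, Store.setNat, vars]
    ring

/-- The registers are used as a stack: the result goes to `R[r]`, temporaries lie above it and below
the arrays at `D`. Since no edge has been added yet, the oracle answers for `G` itself. -/
theorem Ex.compile_runs {n : ℕ} (G : SimpleGraph (Fin n)) (α : ℝ) (D : ℕ) (e : Ex) {d r : ℕ}
    {s : Store n} (hs : s.edges = ∅) (hn : s.nat 0 = n) (he : e.Scoped d) (hr : r + e.regs ≤ D) :
    ∃ s', Runs G α (e.compile D d r) (e.time.eval n) s s' ∧ SameBelow d r D s s' ∧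
      s'.real r = e.eval (natProximity G α) n (s.nat 1) (cells D s) d (vars s) := by
  induction e generalizing d r s with
  | const c =>
    exact ⟨_, (Runs.instr (.realConst r c) s).mono (by simp [time]), SameBelow.setReal s d le_rfl hr _,
      by simp [Store.setReal, Instr.exec, eval]⟩
  | order =>
    exact ⟨_, (Runs.instr (.realOfNat r 0) s).mono (by simp [time]), SameBelow.setReal s d le_rfl hr _,
      by simp [Store.setReal, Instr.exec, eval, hn]⟩
  | budget =>
    exact ⟨_, (Runs.instr (.realOfNat r 1) s).mono (by simp [time]), SameBelow.setReal s d le_rfl hr _,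
      by simp [Store.setReal, Instr.exec, eval]⟩
  | idx v =>
    exact ⟨_, (Runs.instr (.realOfNat r (2 * v + 5)) s).mono (by simp [time]), SameBelow.setReal s d le_rfl hr _,
      by simp [Store.setReal, Instr.exec, eval, vars]⟩
  | cell j v =>
    obtain ⟨s', h1, h2, h3, h4⟩ := Ex.address_runs G α D j v d r s
    refine ⟨_, (h1.seq (Runs.instr (.realLoad r 2) s')).mono (by simp [time]), h2.trans
      (SameBelow.setReal s' d le_rfl hr _), ?_⟩
    simp [Store.setReal, h4, h3, eval, cells, Instr.exec]
  | prox u v =>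
    refine ⟨_, (Runs.instr (.query r (2 * u + 5) (2 * v + 5)) s).mono (by simp [time]), ?_, ?_⟩
    · simp only [Instr.exec]
      split_ifs <;> exact SameBelow.setReal s d le_rfl hr _
    · simp only [Instr.exec, eval, natProximity, vars]
      have : addEdges G s.edges = G := by simp [addEdges, hs]
      rw [this]
      split_ifs with h
      · simp [Store.setReal, h]
      · simp [Store.setReal, h]
  | op o a b iha ihb =>
    simp only [regs] at hr
    obtain ⟨s1, r1, m1, v1⟩ := iha (r := r) hs hn he.1 (by omega)
    have hk := m1.nat 1 (by omega) (by omega) (by omega)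
    obtain ⟨s2, r2, m2, v2⟩ := ihb (d := d) (r := r + 1) (s := s1) (m1.edges.trans hs)
      ((m1.nat 0 (by omega) (by omega) (by omega)).trans hn) he.2 (by omega)
    refine ⟨s2.setReal r (o.apply (s2.real r) (s2.real (r + 1))), ?_, (m1.trans (m2.weaken le_rfl (by omega))).trans
      (SameBelow.setReal s2 d le_rfl (by omega) _), ?_⟩
    · exact (r1.seq (r2.seq (Op.compile_runs G α r r (r + 1) o s2))).mono (by simp [time]; omega)
    · simp only [Store.setReal, Function.update_self, eval]
      rw [v2, m2.real r (by omega), v1, hk, m1.cells_eq]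
      congr 1
      exact eval_congr (j := 0) (fun _ _ => rfl) b he.2 (Or.inr rfl) m1.vars_eq
  | fold o a ih =>
    simp only [regs] at hr
    set f : ℕ → ℝ := fun i => a.eval (natProximity G α) n (s.nat 1) (cells D s) (d + 1)
      (Function.update (vars s) d i) with hf
    obtain ⟨s', hrun, -, hI, hv⟩ := forRange_runs (G := G) (α := α) (c := 2 * d + 5) (by omega)
      (by omega) (P := .seq (a.compile D (d + 1) (r + 1)) (o.compile r r (r + 1)))
      (T := a.time.eval n + 2)
      (fun i t => SameBelow d r D s t ∧ t.real r = o.foldRange f i)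
      (s := s.setReal r ((0 : ℕ) : ℝ)) hn
      ⟨(SameBelow.setReal s d le_rfl (by omega) _).trans ⟨rfl, fun a _ _ ha => by
        have : a ≠ 2 * d + 5 := by omega
        simp [Store.setNat, Function.update_of_ne this], fun _ _ => rfl⟩,
        by simp [Store.setNat, Store.setReal, Op.foldRange]⟩
      (by
        rintro i hi t htn htc ⟨hI, hv⟩
        obtain ⟨t1, r1, m1, v1⟩ := ih (d := d + 1) (r := r + 1) (s := t) (hI.edges.trans hs) htn he
          (by omega)
        refine ⟨_, r1.seq (Op.compile_runs G α r r (r + 1) o t1), ?_, ?_, ?_, ?_⟩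
        · exact (m1.nat 0 (by omega) (by omega) (by omega)).trans htn
        · exact (m1.nat _ (by omega) (by omega) (by omega)).trans htc
        · refine (hI.trans ((m1.weaken (by omega) (by omega)).trans
            (SameBelow.setReal t1 d le_rfl (by omega) _))).trans ⟨rfl, fun a h2 _ ha => ?_,
              fun _ _ => rfl⟩
          have : a ≠ 2 * d + 5 := by omega
          simp [Store.setNat, Function.update_of_ne this, Function.update_of_ne h2]
        · simp only [Store.setNat, Store.setReal, Function.update_self, Op.foldRange]
          rw [m1.real r (by omega), hv, v1, hI.nat 1 (by omega) (by omega) (by omega), hI.cells_eq]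
          congr 1
          refine eval_congr (j := 0) (fun _ _ => rfl) a he (Or.inr rfl) fun v hvd => ?_
          rcases eq_or_ne v d with rfl | hne
          · simpa [vars] using htc
          · rw [Function.update_of_ne hne]
            exact hI.vars_eq v (by omega))
    refine ⟨s', ?_, hI, hv⟩
    exact ((Runs.instr (.realConst r 0) s).seq hrun).mono (le_of_eq (by simp [time]; ring))

/-! ### Array commands and their compilation. -/

/-- Commands on arrays: assign to all entries below `n` of an array at once, where the variable `0`
is the position of the entry; compose; repeat `n` times. -/
inductive Cmd : Type
  | assign (j : Fin 16) (e : Ex)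
  | seq (c c' : Cmd)
  | rep (c : Cmd)

namespace Cmd

/-- No assignment reads the array that it changes. -/
def Valid : Cmd → Prop
  | assign j e => e.Scoped 1 ∧ e.Avoids j
  | seq c c' => c.Valid ∧ c'.Valid
  | rep c => c.Valid

/-- The effect of a command on the arrays. -/
noncomputable def sem (P : ℕ → ℕ → ℝ) (n k : ℕ) : Cmd → (Fin 16 → ℕ → ℝ) → Fin 16 → ℕ → ℝ
  | assign j e, σ => fun j' x =>
      if j' = j ∧ x < n then e.eval P n k σ 1 (fun _ => x) else σ j' x
  | seq c c', σ => c'.sem P n k (c.sem P n k σ)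
  | rep c, σ => (c.sem P n k)^[n] σ

/-- The number of real registers that the command takes. -/
def regs : Cmd → ℕ
  | assign _ e => e.regs
  | seq c c' => max c.regs c'.regs
  | rep c => c.regs

/-- The program of a command that is nested in `l` repetitions. -/
def compile (D : ℕ) : ℕ → Cmd → Program
  | _, assign j e => forRange 5 (.seq (e.compile D 1 0)
      (.seq (Ex.address D j 0) (.instr (.realStore 2 0))))
  | l, seq c c' => .seq (c.compile D l) (c'.compile D l)
  | l, rep c => forRange (2 * l + 4) (c.compile D (l + 1))

/-- A bound for the number of steps of a command. -/
noncomputable def time : Cmd → Polynomial ℕ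
  | assign _ e => 2 + Polynomial.X * (e.time + 11)
  | seq c c' => c.time + c'.time
  | rep c => 2 + Polynomial.X * (c.time + 3)

theorem _root_.BroadcastImprovement.Ex.regs_pos (e : Ex) : 0 < e.regs := by
  cases e <;> simp [Ex.regs]

/-- Counters of repetitions live in even cells from `N[4]` on, variables of expressions in odd cells
from `N[5]` on, so nested loops do not disturb each other. -/
theorem compile_runs {n : ℕ} (G : SimpleGraph (Fin n)) (α : ℝ) (D : ℕ) (c : Cmd) {l : ℕ}
    {s : Store n} (hs : s.edges = ∅) (hn : s.nat 0 = n) (hc : c.Valid) (hr : c.regs ≤ D) :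
    ∃ s', Runs G α (c.compile D l) (c.time.eval n) s s' ∧ s'.edges = ∅ ∧ s'.nat 0 = n ∧
      s'.nat 1 = s.nat 1 ∧ (∀ v < l, s'.nat (2 * v + 4) = s.nat (2 * v + 4)) ∧
      cells D s' = c.sem (natProximity G α) n (s.nat 1) (cells D s) := by
  induction c generalizing l s with
  | assign j e =>
    simp only [regs] at hr
    have hpos := e.regs_pos
    set f : ℕ → ℝ := fun x => e.eval (natProximity G α) n (s.nat 1) (cells D s) 1 (fun _ => x) with hf
    obtain ⟨s', hrun, hn', h1, h2, h3, h4⟩ := forRange_runs (G := G) (α := α) (c := 5) (by omega)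
      (by omega) (P := .seq (e.compile D 1 0)
        (.seq (Ex.address D j 0) (.instr (.realStore 2 0))))
      (T := e.time.eval n + (7 + 1))
      (fun i t => t.edges = ∅ ∧ t.nat 1 = s.nat 1 ∧ (∀ v, t.nat (2 * v + 4) = s.nat (2 * v + 4)) ∧
        cells D t = fun j' x => if j' = j ∧ x < i then f x else cells D s j' x)
      (s := s) hn
      ⟨hs, by simp [Store.setNat], fun v => by
        simp [Store.setNat], by
        simp
        rfl⟩
      (by
        rintro i hi t htn htc ⟨h1, h2, h3, h4⟩
        obtain ⟨t1, r1, m1, v1⟩ := Ex.compile_runs G α D e (d := 1) (r := 0) (s := t) h1 htn hc.1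
          (by omega)
        obtain ⟨t2, r2, m2, v2, a2⟩ := Ex.address_runs G α D j 0 1 0 t1
        have hv : vars t1 0 = i := (m1.nat _ (by omega) (by omega) (by omega)).trans htc
        have m := m1.trans m2
        have hval : t1.real 0 = f i := by
          rw [v1, h2]
          -- The entries of `j` below `i` are already overwritten, which is harmless because `e`
          -- avoids `j`.
          refine Ex.eval_congr (j := j) (fun j' hj' => ?_) e hc.1 (Or.inl hc.2) fun v hv => ?_
          · ext x
            simp [h4, hj']
          · obtain rfl : v = 0 := by omega
            exact htc
        refine ⟨_, r1.seq (r2.seq (Runs.instr _ _)), ?_, ?_, ?_, ?_, ?_, ?_⟩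
        · exact (m.nat _ (by omega) (by omega) (by omega)).trans htn
        · exact (m.nat _ (by omega) (by omega) (by omega)).trans htc
        · exact m.edges.trans h1
        · exact (m.nat _ (by omega) (by omega) (by omega)).trans h2
        · intro v
          have e5 : 2 * v + 4 ≠ 5 := by omega
          have e2 : 2 * v + 4 ≠ 2 := by omega
          simp only [Store.setNat, Instr.exec, Store.setReal, Function.update_of_ne e5,
            Function.update_of_ne e2]
          exact (m.nat _ (by omega) (by omega) (by omega)).trans (h3 v)
        · ext j' x
          have hcell := congrFun (congrFun m.cells_eq j') x
          rw [h4] at hcell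
          simp only [cells, Store.setNat, Instr.exec, Store.setReal, a2, hv, Function.update_apply]
          simp only [cells] at hcell
          have hj := j.2
          have hj' := j'.2
          by_cases hjx : j' = j ∧ x = i
          · obtain ⟨rfl, rfl⟩ := hjx
            simp [v2, hval]
          -- Array indices are below 16, so an address determines both the array and the position.
          · have : ¬ D + (j' : ℕ) + 16 * x = D + j + 16 * i := fun h => hjx (by
              constructor
              · ext
                omega
              · omega)
            rw [if_neg this, hcell]
            by_cases h : j' = j
            · have : x < i + 1 ↔ x < i := by
                have : x ≠ i := fun hx => hjx ⟨h, hx⟩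
                omega
              simp [h, this]
            · simp [h])
    exact ⟨s', hrun.mono (le_of_eq (by simp [time])), h1, hn', h2, fun v _ => h3 v, h4⟩
  | seq c c' ih ih' =>
    simp only [regs] at hr
    obtain ⟨s1, r1, e1, n1, k1, l1, v1⟩ := ih (l := l) hs hn hc.1 (by omega)
    obtain ⟨s2, r2, e2, n2, k2, l2, v2⟩ := ih' (l := l) e1 n1 hc.2 (by omega)
    refine ⟨s2, (r1.seq r2).mono (le_of_eq (by simp [time])), e2, n2, k2.trans k1,
      fun v hv => (l2 v hv).trans (l1 v hv), ?_⟩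
    rw [v2, v1, k1]
    rfl
  | rep c ih =>
    obtain ⟨s', hrun, hn', h1, h2, h3, h4⟩ := forRange_runs (G := G) (α := α) (c := 2 * l + 4)
      (by omega) (by omega) (P := c.compile D (l + 1)) (T := c.time.eval n)
      (fun i t => t.edges = ∅ ∧ t.nat 1 = s.nat 1 ∧
        (∀ v < l, t.nat (2 * v + 4) = s.nat (2 * v + 4)) ∧
        cells D t = (c.sem (natProximity G α) n (s.nat 1))^[i] (cells D s))
      (s := s) hn
      ⟨hs, by
        simp [Store.setNat], fun v hv => by
        have : 2 * v + 4 ≠ 2 * l + 4 := by omega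
        simp [Store.setNat, Function.update_of_ne this], rfl⟩
      (by
        rintro i hi t htn htc ⟨h1, h2, h3, h4⟩
        obtain ⟨t1, r1, e1, n1, k1, l1, v1⟩ := ih (l := l + 1) h1 htn hc hr
        refine ⟨t1, r1, n1, (l1 l (by omega)).trans htc, e1, ?_, ?_, ?_⟩
        · simp [Store.setNat, k1, h2]
        · intro v hv
          have e1 : 2 * v + 4 ≠ 2 * l + 4 := by omega
          have e2 : 2 * v + 4 ≠ 2 := by omega
          simp only [Store.setNat, Function.update_of_ne e1, Function.update_of_ne e2]
          exact (l1 v (by omega)).trans (h3 v hv)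
        · rw [Function.iterate_succ_apply', ← h4, ← h2]
          exact v1)
    exact ⟨s', hrun.mono (le_of_eq (by simp [time])), h1, hn', h2, h3, h4⟩

end Cmd

/-! ### Output of the star. -/

/-- Join the vertex `0` to all other vertices with a positive entry in the array `j`. -/
def outputStar (D : ℕ) (j : Fin 16) : Program :=
  forRange 5 <| .seq (.seq (Ex.address D j 0) (.seq (.instr (.realLoad 0 2))
      (.seq (.instr (.realConst 1 0)) (.instr (.natConst 4 0))))) <|
    .ite (.realLt 1 0) (.ite (.isEdge 4 5) (.instr (.natConst 2 0))
      (.ite (.natLt 4 5) (.instr (.insertEdge 4 5)) (.instr (.natConst 2 0))))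
      (.instr (.natConst 2 0))

theorem outputStar_runs {n : ℕ} (G : SimpleGraph (Fin n)) (α : ℝ) {D : ℕ} (hD : 2 ≤ D) (j : Fin 16)
    {s : Store n} (hs : s.edges = ∅) (hn : s.nat 0 = n) :
    ∃ s', Runs G α (outputStar D j) (2 + n * 17) s s' ∧ ∀ e, e ∈ s'.edges ↔
      ∃ x y : Fin n, x.1 = 0 ∧ y ≠ x ∧ ¬ G.Adj x y ∧ 0 < cells D s j y ∧ e = s(x, y) := by
  obtain ⟨s', hrun, -, h1, h2⟩ := forRange_runs (G := G) (α := α) (c := 5) (by omega)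
    (by omega) (P := .seq (.seq (Ex.address D j 0) (.seq (.instr (.realLoad 0 2))
      (.seq (.instr (.realConst 1 0)) (.instr (.natConst 4 0))))) <|
    .ite (.realLt 1 0) (.ite (.isEdge 4 5) (.instr (.natConst 2 0))
      (.ite (.natLt 4 5) (.instr (.insertEdge 4 5)) (.instr (.natConst 2 0))))
      (.instr (.natConst 2 0)))
    (T := 14)
    (fun i t => cells D t = cells D s ∧ ∀ e, e ∈ t.edges ↔ ∃ x y : Fin n, y.1 < i ∧
      x.1 = 0 ∧ y ≠ x ∧ ¬ G.Adj x y ∧ 0 < cells D s j y ∧ e = s(x, y))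
    (s := s) hn ⟨rfl, by simp [Store.setNat, hs]⟩
    (by
      rintro i hi t htn htc ⟨hcell, hedge⟩
      obtain ⟨t1, r1, m1, v1, a1⟩ := Ex.address_runs G α D j 0 1 0 t
      have hv : vars t 0 = i := htc
      obtain ⟨t2, r2, ht2⟩ : ∃ t2, Runs G α (.seq (Ex.address D j 0) (.seq (.instr (.realLoad 0 2))
          (.seq (.instr (.realConst 1 0)) (.instr (.natConst 4 0))))) 10 t t2 ∧
          (t2.nat 0 = n ∧ t2.nat 5 = i ∧ t2.nat 4 = 0 ∧ t2.real 0 = cells D s j i ∧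
          t2.real 1 = 0 ∧ cells D t2 = cells D s ∧ t2.edges = t.edges) := by
        refine ⟨_, r1.seq ((Runs.instr _ _).seq ((Runs.instr _ _).seq (Runs.instr _ _))),
          ?_, ?_, ?_, ?_, ?_, ?_, ?_⟩
        · exact (m1.nat _ (by omega) (by omega) (by omega)).trans htn
        · exact (m1.nat _ (by omega) (by omega) (by omega)).trans htc
        · simp [Instr.exec, Store.setNat]
        · rw [← hcell]
          simp [Instr.exec, Store.setNat, Store.setReal, a1, v1, hv, cells]
        · simp [Instr.exec, Store.setNat, Store.setReal]
        · rw [← hcell, ← m1.cells_eq]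
          ext j' x
          have h0 : D + (j' : ℕ) + 16 * x ≠ 0 := by omega
          have h1 : D + (j' : ℕ) + 16 * x ≠ 1 := by omega
          simp [Instr.exec, Store.setNat, Store.setReal, cells, Function.update_of_ne h0,
            Function.update_of_ne h1]
        · exact m1.edges
      obtain ⟨n2, c2, z2, x2, y2, k2, e2⟩ := ht2
      have hlt : 0 < n := by omega
      -- A common treatment of the three branches that insert nothing: entry not positive, edge
      -- already in `G`, or the centre itself.
      have hnop : ∀ (hno : ∀ x : Fin n, x.1 = 0 → (⟨i, hi⟩ : Fin n) ≠ x → ¬ G.Adj x ⟨i, hi⟩ →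
          ¬ 0 < cells D s j i), ∀ Q, Runs G α Q 4 t2 (t2.setNat 2 0) → ∃ s', Runs G α (.seq (.seq
          (Ex.address D j 0) (.seq (.instr (.realLoad 0 2))
          (.seq (.instr (.realConst 1 0)) (.instr (.natConst 4 0))))) Q) 14 t s' ∧ s'.nat 0 = n ∧
          s'.nat 5 = i ∧ (cells D ((s'.setNat 2 1).setNat 5 (i + 1)) = cells D s ∧
          ∀ e, e ∈ ((s'.setNat 2 1).setNat 5 (i + 1)).edges ↔ ∃ x y : Fin n, y.1 < i + 1 ∧
            x.1 = 0 ∧ y ≠ x ∧ ¬ G.Adj x y ∧ 0 < cells D s j y ∧ e = s(x, y)) := by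
        intro hno Q hQ
        refine ⟨_, r2.seq hQ, n2, c2, k2, fun e => ?_⟩
        change e ∈ t2.edges ↔ _
        rw [e2, hedge]
        constructor
        · rintro ⟨x, y, hy, h⟩
          exact ⟨x, y, by omega, h⟩
        · rintro ⟨x, y, hy, hx, hyx, hadj, hpos, rfl⟩
          refine ⟨x, y, ?_, hx, hyx, hadj, hpos, rfl⟩
          by_contra hyi
          obtain rfl : y = ⟨i, hi⟩ := Fin.ext (by simp; omega)
          exact hno x hx hyx hadj hpos
      by_cases hpos : 0 < cells D s j i
      · have hp : Test.holds G t2 (.realLt 1 0) := by simpa [Test.holds, x2, y2] using hpos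
        by_cases hadj : Test.holds G t2 (.isEdge 4 5)
        · refine hnop ?_ _ (Runs.ite_true hp ((Runs.ite_true hadj (Runs.instr _ _)).mono
            (by norm_num)))
          intro x hx _ hxa
          exfalso
          apply hxa
          obtain ⟨ha, hb, h⟩ := hadj
          convert h using 1
          · exact Fin.ext (by simp [z2, hx])
          · exact Fin.ext (by simp [c2])
        · by_cases hz : i = 0
          · refine hnop ?_ _ (Runs.ite_true hp (Runs.ite_false hadj (Runs.ite_false
              (by simp [Test.holds, z2, c2, hz]) (Runs.instr _ _))))
            intro x hx hne
            exact absurd (Fin.ext (by simp [hx, hz])) hne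
          · refine ⟨_, r2.seq (Runs.ite_true hp (Runs.ite_false hadj (Runs.ite_true
              (by simp [Test.holds, z2, c2]; omega) (Runs.instr _ _)))), ?_⟩
            have hdef : (Instr.insertEdge 4 5).exec G α t2 =
                { t2 with edges := insert s(⟨0, hlt⟩, ⟨i, hi⟩) t2.edges } := by
              have h45 : t2.nat 4 < n ∧ t2.nat 5 < n := by omega
              simp only [Instr.exec, h45, and_self, dif_pos]
              simp only [z2, c2]
            rw [hdef]
            refine ⟨n2, c2, k2, fun e => ?_⟩
            change e ∈ insert s(⟨0, hlt⟩, ⟨i, hi⟩) t2.edges ↔ _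
            rw [Finset.mem_insert, e2, hedge]
            constructor
            · rintro (rfl | ⟨x, y, hy, h⟩)
              · refine ⟨⟨0, hlt⟩, ⟨i, hi⟩, by simp, rfl, by simpa [Fin.ext_iff] using hz, ?_, hpos,
                  rfl⟩
                intro h
                exact hadj ⟨by omega, by omega, by simpa [z2, c2] using h⟩
              · exact ⟨x, y, by omega, h⟩
            · rintro ⟨x, y, hy, hx, hyx, ha, hp', rfl⟩
              by_cases hyi : y.1 < i
              · exact Or.inr ⟨x, y, hyi, hx, hyx, ha, hp', rfl⟩
              · left
                obtain rfl : y = ⟨i, hi⟩ := Fin.ext (by simp; omega)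
                obtain rfl : x = ⟨0, hlt⟩ := Fin.ext hx
                rfl
      · exact hnop (fun _ _ _ _ => hpos) _ ((Runs.ite_false (by simpa [Test.holds, x2, y2] using hpos)
          (Runs.instr _ _)).mono (by norm_num)))
  refine ⟨s', hrun, fun e => ?_⟩
  rw [h2]
  constructor
  · rintro ⟨x, y, -, h⟩
    exact ⟨x, y, h⟩
  · rintro ⟨x, y, h⟩
    exact ⟨x, y, y.2, h⟩

/-- Array commands compute stars in polynomial time. -/
theorem Cmd.exists_program (c : Cmd) (hc : c.Valid) (j : Fin 16) :
    ∃ (P : Program) (p : Polynomial ℕ), ∀ (n k : ℕ) (G : SimpleGraph (Fin n)) (α : ℝ),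
      ∃ (t : ℕ) (s : Store n), Exec G α P (Store.init n k α) t s ∧ t ≤ p.eval n ∧
        ∀ e, e ∈ s.edges ↔ ∃ x y : Fin n, x.1 = 0 ∧ y ≠ x ∧ ¬ G.Adj x y ∧
          0 < c.sem (natProximity G α) n k (fun _ _ => 0) j y ∧ e = s(x, y) := by
  -- The extra two ensure that `R[0]` and `R[1]`, which `outputStar` uses, lie below the arrays.
  set D := c.regs + 2 with hD
  refine ⟨.seq (c.compile D 0) (outputStar D j), c.time + (2 + Polynomial.X * 17), ?_⟩
  intro n k G α
  obtain ⟨s1, r1, e1, n1, k1, -, v1⟩ := Cmd.compile_runs G α D c (l := 0)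
    (s := Store.init n k α) rfl (by simp [Store.init]) hc (by omega)
  obtain ⟨s2, r2, h2⟩ := outputStar_runs G α (D := D) (by omega) j e1 n1
  obtain ⟨t, ht, hr⟩ := r1.seq r2
  refine ⟨t, s2, hr, by simpa using ht, fun e => ?_⟩
  have h0 : cells D (Store.init n k α) = fun _ _ => 0 := by
    ext j x
    simp [cells, Store.init, hD]
  have hk : (Store.init n k α).nat 1 = k := by simp [Store.init]
  rw [h2, v1, h0, hk]

/-! ### Folds as sums and maxima. -/

theorem Op.foldRange_add (f : ℕ → ℝ) (m : ℕ) : Op.add.foldRange f m = ∑ i ∈ Finset.range m, f i := by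
  induction m with
  | zero => rfl
  | succ m ih => rw [Finset.sum_range_succ, ← ih]; rfl

theorem Op.foldRange_max_le_iff (f : ℕ → ℝ) (m : ℕ) (c : ℝ) :
    Op.max.foldRange f m ≤ c ↔ 0 ≤ c ∧ ∀ i < m, f i ≤ c := by
  induction m with
  | zero => simp [foldRange]
  | succ m ih =>
    have : Op.max.foldRange f (m + 1) = Max.max (Op.max.foldRange f m) (f m) := by
      rw [max_def_lt]; rfl
    rw [this, max_le_iff, ih, Nat.forall_lt_succ_right, and_assoc]

theorem Op.foldRange_max_eq (f : ℕ → ℝ) (m : ℕ) :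
    Op.max.foldRange f m = 0 ∨ ∃ i < m, Op.max.foldRange f m = f i := by
  induction m with
  | zero => exact Or.inl rfl
  | succ m ih =>
    simp only [foldRange, Op.apply]
    split_ifs
    · exact Or.inr ⟨m, by omega, rfl⟩
    · exact ih.imp id fun ⟨i, hi, h⟩ => ⟨i, by omega, h⟩

theorem Op.foldRange_max_nonneg (f : ℕ → ℝ) (m : ℕ) : 0 ≤ Op.max.foldRange f m :=
  ((Op.foldRange_max_le_iff f m _).1 le_rfl).1

theorem Op.le_foldRange_max (f : ℕ → ℝ) {m i : ℕ} (hi : i < m) : f i ≤ Op.max.foldRange f m :=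
  ((Op.foldRange_max_le_iff f m _).1 le_rfl).2 i hi

theorem Op.apply_max (x y : ℝ) : Op.max.apply x y = Max.max x y := by
  rw [max_def_lt]; rfl

/-! ### Greedy choice of servers for given weights. -/

section Greedy
variable {P : ℕ → ℕ → ℝ} {n κ : ℕ} {w : ℕ → ℝ}

/-- Vertices closer to `u` than `x` carry less than one part in `8κ` of the weight. -/
abbrev Top (P : ℕ → ℕ → ℝ) (n κ : ℕ) (w : ℕ → ℝ) (u x : ℕ) : Prop :=
  8 * (κ : ℝ) * ∑ y ∈ Finset.range n, w y * (if P u x < P u y then 1 else 0) <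
    ∑ y ∈ Finset.range n, w y

/-- Take the closest vertex to `u` that is not top. All vertices strictly closer are top, and they
carry at least `1 / (8κ)` of the weight, precisely because this one is not top. -/
theorem le_top_mass (hκ : 0 < κ) (hw : ∀ x < n, 0 < w x) (u : ℕ) :
    ∑ y ∈ Finset.range n, w y ≤
      8 * (κ : ℝ) * ∑ x ∈ Finset.range n, w x * (if Top P n κ w u x then 1 else 0) := by
  have hκ' : (1 : ℝ) ≤ κ := by exact_mod_cast hκ
  have hW : 0 ≤ ∑ y ∈ Finset.range n, w y :=
    Finset.sum_nonneg fun x hx => (hw x (Finset.mem_range.1 hx)).le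
  by_cases hN : ∃ x ∈ Finset.range n, ¬ Top P n κ w u x
  · obtain ⟨x, hx⟩ := hN
    have hne : ({x ∈ Finset.range n | ¬ Top P n κ w u x}).Nonempty :=
      ⟨x, Finset.mem_filter.2 hx⟩
    obtain ⟨x₀, hx₀, hmax⟩ := Finset.exists_max_image _ (P u) hne
    refine (not_lt.1 (Finset.mem_filter.1 hx₀).2).trans ?_
    refine mul_le_mul_of_nonneg_left (Finset.sum_le_sum fun y hy => ?_) (by positivity)
    refine mul_le_mul_of_nonneg_left ?_ (hw y (Finset.mem_range.1 hy)).le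
    by_cases hT : Top P n κ w u y
    · rw [if_pos hT]
      split_ifs <;> norm_num
    · rw [if_neg hT, if_neg (not_lt.2 (hmax y (Finset.mem_filter.2 ⟨hy, hT⟩)))]
  · push Not at hN
    have : ∑ x ∈ Finset.range n, w x * (if Top P n κ w u x then 1 else 0) =
        ∑ x ∈ Finset.range n, w x :=
      Finset.sum_congr rfl fun x hx => by rw [if_pos (hN x hx), mul_one]
    rw [this]
    nlinarith

/-- The vertices that no vertex of `S` serves. -/
noncomputable def unserved (P : ℕ → ℕ → ℝ) (n κ : ℕ) (w : ℕ → ℝ) (S : Finset ℕ) : Finset ℕ :=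
  {u ∈ Finset.range n | ∀ y ∈ S, ¬ Top P n κ w u y}

/-- Averaging: a vertex drawn with probability proportional to its weight is top for each given `u`
with probability at least `1 / (8κ)`, by `le_top_mass`. -/
theorem exists_le_card_top (hn : 0 < n) (hκ : 0 < κ) (hw : ∀ x < n, 0 < w x) (U : Finset ℕ) :
    ∃ x < n, (U.card : ℝ) ≤ 8 * (κ : ℝ) * ({u ∈ U | Top P n κ w u x}).card := by
  by_contra! hcon
  have h1 : ∑ x ∈ Finset.range n, w x * (8 * (κ : ℝ) * ({u ∈ U | Top P n κ w u x}).card) <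
      ∑ x ∈ Finset.range n, w x * U.card :=
    Finset.sum_lt_sum_of_nonempty ⟨0, Finset.mem_range.2 hn⟩ fun x hx =>
      mul_lt_mul_of_pos_left (hcon x (Finset.mem_range.1 hx)) (hw x (Finset.mem_range.1 hx))
  have h2 : ∑ x ∈ Finset.range n, w x * (8 * (κ : ℝ) * ({u ∈ U | Top P n κ w u x}).card) =
      ∑ u ∈ U, 8 * (κ : ℝ) * ∑ x ∈ Finset.range n, w x * (if Top P n κ w u x then 1 else 0) := by
    simp only [Finset.mul_sum]
    rw [Finset.sum_comm]
    refine Finset.sum_congr rfl fun x _ => ?_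
    rw [← Finset.mul_sum, ← Finset.mul_sum, Finset.sum_boole]
    ring
  have h3 : ∑ _u ∈ U, ∑ y ∈ Finset.range n, w y ≤ ∑ u ∈ U,
      8 * (κ : ℝ) * ∑ x ∈ Finset.range n, w x * (if Top P n κ w u x then 1 else 0) :=
    Finset.sum_le_sum fun u _ => le_top_mass hκ hw u
  rw [h2, ← Finset.sum_mul] at h1
  rw [Finset.sum_const, nsmul_eq_mul] at h3
  linarith

/-- One step of the greedy choice of servers. -/
def GreedyStep (P : ℕ → ℕ → ℝ) (n κ : ℕ) (w : ℕ → ℝ) (S S' : Finset ℕ) : Prop :=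
  ∃ x₀ < n, (∀ x < n, ({u ∈ unserved P n κ w S | Top P n κ w u x}).card ≤
      ({u ∈ unserved P n κ w S | Top P n κ w u x₀}).card) ∧
    S' = if 0 < ({u ∈ unserved P n κ w S | Top P n κ w u x₀}).card then insert x₀ S else S

/-- What holds after `i` greedy steps. -/
structure GreedyInv (P : ℕ → ℕ → ℝ) (n κ : ℕ) (w : ℕ → ℝ) (i : ℕ) (S : Finset ℕ) : Prop where
  sub : S ⊆ Finset.range n
  left : (unserved P n κ w S).card ≤ n - i
  decay : ((unserved P n κ w S).card : ℝ) ≤ n * (1 - 1 / (8 * (κ : ℝ))) ^ S.card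
  size : S.card = 0 ∨ 1 ≤ n * (1 - 1 / (8 * (κ : ℝ))) ^ (S.card - 1)

theorem GreedyInv.zero : GreedyInv P n κ w 0 ∅ where
  sub := by simp
  left := by
    exact (Finset.card_filter_le (Finset.range n) _).trans (by simp)
  decay := by
    simp [unserved]
  size := by simp

/-- The maximiser serves at least the average fraction `1 / (8κ)` of the unserved vertices, which
gives `decay`. A vertex is added only while someone is unserved, so the `decay` bound before the
last insertion was at least one; `size` records this. -/
theorem GreedyInv.step (hn : 0 < n) (hκ : 0 < κ) (hw : ∀ x < n, 0 < w x) {i : ℕ} {S S' : Finset ℕ}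
    (h : GreedyInv P n κ w i S) (hs : GreedyStep P n κ w S S') : GreedyInv P n κ w (i + 1) S' := by
  obtain ⟨x₀, hx₀, hmax, rfl⟩ := hs
  obtain ⟨x, hx, hcard⟩ := exists_le_card_top (P := P) hn hκ hw (unserved P n κ w S)
  have hκ' : (0 : ℝ) < κ := by exact_mod_cast hκ
  set U := unserved P n κ w S with hU
  set N := ({u ∈ U | Top P n κ w u x₀}).card with hN
  have hle : (U.card : ℝ) ≤ 8 * (κ : ℝ) * N := by
    refine hcard.trans (mul_le_mul_of_nonneg_left ?_ (by positivity))
    exact_mod_cast hmax x hx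
  split_ifs with hpos
  · have hnot : x₀ ∉ S := by
      intro hmem
      obtain ⟨u, hu⟩ := Finset.card_pos.1 hpos
      obtain ⟨hu1, hu2⟩ := Finset.mem_filter.1 hu
      exact (Finset.mem_filter.1 hu1).2 x₀ hmem hu2
    have hU' : unserved P n κ w (insert x₀ S) = {u ∈ U | ¬ Top P n κ w u x₀} := by
      ext u
      simp only [unserved, Finset.mem_filter, Finset.mem_insert, forall_eq_or_imp, hU]
      tauto
    have hsplit : N + (unserved P n κ w (insert x₀ S)).card = U.card := by
      rw [hU']
      exact Finset.card_filter_add_card_filter_not _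
    have hsplit' : (N : ℝ) + (unserved P n κ w (insert x₀ S)).card = U.card := by
      exact_mod_cast hsplit
    have hfac : (0 : ℝ) ≤ 1 - 1 / (8 * (κ : ℝ)) := by
      have : (1 : ℝ) ≤ κ := by exact_mod_cast hκ
      rw [sub_nonneg, div_le_one (by positivity)]
      linarith
    refine ⟨Finset.insert_subset (Finset.mem_range.2 hx₀) h.sub, ?_, ?_, Or.inr ?_⟩
    · have := h.left
      rw [← hU] at this
      omega
    · rw [Finset.card_insert_of_notMem hnot, pow_succ, ← mul_assoc]
      refine le_trans ?_ (mul_le_mul_of_nonneg_right h.decay hfac)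
      have : (U.card : ℝ) * (1 / (8 * (κ : ℝ))) ≤ N := by
        rw [mul_one_div, div_le_iff₀ (by positivity)]
        linarith
      linarith
    · rw [Finset.card_insert_of_notMem hnot, Nat.add_sub_cancel]
      refine le_trans ?_ h.decay
      have : 1 ≤ U.card := by omega
      exact_mod_cast this
  · have hN0 : N = 0 := by omega
    -- A maximal gain of zero already means that nobody is unserved.
    have hU0 : U.card = 0 := by
      rw [hN0] at hle
      have : (U.card : ℝ) ≤ 0 := by simpa using hle
      exact_mod_cast le_antisymm this (Nat.cast_nonneg _)
    exact ⟨h.sub, by rw [← hU, hU0]; omega, h.decay, h.size⟩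

theorem GreedyInv.exists_top {S : Finset ℕ} (h : GreedyInv P n κ w n S) {u : ℕ} (hu : u < n) :
    ∃ y ∈ S, Top P n κ w u y := by
  by_contra hcon
  replace hcon : ∀ y ∈ S, ¬ Top P n κ w u y := fun y hy hT => hcon ⟨y, hy, hT⟩
  have h0 : unserved P n κ w S = ∅ := Finset.card_eq_zero.1 (by have := h.left; omega)
  have : u ∈ unserved P n κ w S := Finset.mem_filter.2 ⟨Finset.mem_range.2 hu, hcon⟩
  simp [h0] at this

/-- By `1 - x ≤ exp (-x)`, the field `size` gives `1 ≤ n * exp (-(|S| - 1) / (8κ))`; take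
logarithms. -/
theorem GreedyInv.card_le {i : ℕ} {S : Finset ℕ} (hn : 0 < n) (hκ : 0 < κ)
    (h : GreedyInv P n κ w i S) : (S.card : ℝ) ≤ 8 * κ * Real.log n + 1 := by
  have hn' : (1 : ℝ) ≤ n := by exact_mod_cast hn
  have hκ' : (1 : ℝ) ≤ κ := by exact_mod_cast hκ
  have hlog := Real.log_nonneg hn'
  rcases h.size with h0 | h1
  · rw [h0, Nat.cast_zero]
    positivity
  · rcases Nat.eq_zero_or_pos S.card with h0 | hpos
    · rw [h0, Nat.cast_zero]
      positivity
    set j := S.card - 1 with hj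
    have hfac : (0 : ℝ) ≤ 1 - 1 / (8 * (κ : ℝ)) := by
      rw [sub_nonneg, div_le_one (by positivity)]
      linarith
    have hexp : (1 - 1 / (8 * (κ : ℝ))) ^ j ≤ Real.exp (-(j / (8 * κ))) := by
      refine (pow_le_pow_left₀ hfac (Real.one_sub_le_exp_neg _) j).trans (le_of_eq ?_)
      rw [← Real.exp_nat_mul]
      congr 1
      ring
    have h2 : 1 ≤ (n : ℝ) * Real.exp (-(j / (8 * κ))) :=
      h1.trans (mul_le_mul_of_nonneg_left hexp (by positivity))
    have h3 := Real.log_le_log one_pos h2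
    rw [Real.log_one, Real.log_mul (by positivity) (Real.exp_pos _).ne', Real.log_exp] at h3
    have h4 : (j : ℝ) / (8 * κ) ≤ Real.log n := by linarith
    rw [div_le_iff₀ (by positivity)] at h4
    have h5 : (S.card : ℝ) = j + 1 := by
      have : S.card = j + 1 := by omega
      exact_mod_cast this
    rw [h5]
    linarith

end Greedy

/-- The indicator of the first maximum of `A` below `n`. -/
noncomputable def firstMax (n : ℕ) (A : ℕ → ℝ) (x : ℕ) : ℝ :=
  if ∑ y ∈ Finset.range n, ((if A x < A y then 1 else 0) +
    (if (y : ℝ) < x then 1 else 0) * (1 - if A y < A x then 1 else 0)) < (1 : ℝ) then 1 else 0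

/-- The summand of `y` in `firstMax` is at least one if `y` beats `x` or ties with it at an earlier
position, and zero otherwise. Breaking ties makes the indicator mark one vertex only, so that sums
against it read off a single value. -/
theorem exists_firstMax {n : ℕ} (hn : 0 < n) (A : ℕ → ℝ) :
    ∃ x₀ < n, (∀ y < n, A y ≤ A x₀) ∧ ∀ x < n, firstMax n A x = if x = x₀ then 1 else 0 := by
  classical
  have hex : ∃ x, x < n ∧ ∀ y < n, A y ≤ A x := by
    obtain ⟨x, hx, h⟩ := Finset.exists_max_image (Finset.range n) A ⟨0, Finset.mem_range.2 hn⟩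
    exact ⟨x, Finset.mem_range.1 hx, fun y hy => h y (Finset.mem_range.2 hy)⟩
  obtain ⟨h1, h2⟩ := Nat.find_spec hex
  refine ⟨Nat.find hex, h1, h2, fun x hx => ?_⟩
  have hterm : ∀ y ∈ Finset.range n, (0 : ℝ) ≤ (if A x < A y then 1 else 0) +
      (if (y : ℝ) < x then 1 else 0) * (1 - if A y < A x then 1 else 0) := by
    intro y _
    split_ifs <;> norm_num
  unfold firstMax
  by_cases hxx : x = Nat.find hex
  · rw [if_pos hxx, if_pos]
    rw [Finset.sum_eq_zero]
    · exact one_pos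
    intro y hy
    have hyn := Finset.mem_range.1 hy
    have a1 : ¬ A x < A y := not_lt.2 (hxx ▸ h2 y hyn)
    rw [if_neg a1, zero_add]
    by_cases hyx : y < x
    · have : A y < A x := by
        by_contra hle
        refine Nat.find_min hex (hxx ▸ hyx) ⟨hyn, fun z hz => ?_⟩
        exact (h2 z hz).trans (hxx ▸ not_lt.1 hle)
      simp [this]
    · simp [hyx]
  · rw [if_neg hxx, if_neg]
    intro hlt
    have hall : ∀ y < n, (if A x < A y then 1 else 0) +
      (if (y : ℝ) < x then 1 else 0) * (1 - if A y < A x then 1 else 0) < (1 : ℝ) := fun y hy =>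
      (Finset.single_le_sum hterm (Finset.mem_range.2 hy)).trans_lt hlt
    have hmax : ∀ y < n, A y ≤ A x := by
      intro y hy
      by_contra hcon
      have := hall y hy
      rw [if_pos (not_le.1 hcon), if_neg (not_lt.2 (not_le.1 hcon).le)] at this
      split_ifs at this <;> norm_num at this
    have hle : Nat.find hex ≤ x := Nat.find_min' hex ⟨hx, hmax⟩
    have hlt' : ((Nat.find hex : ℕ) : ℝ) < x := by
      exact_mod_cast lt_of_le_of_ne hle fun h => hxx h.symm
    have := hall _ h1
    rw [if_pos hlt', if_neg (not_lt.2 (h2 x hx)), if_neg (not_lt.2 (hmax _ h1))] at this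
    norm_num at this

theorem Cmd.sem_assign_self {P : ℕ → ℕ → ℝ} {n k : ℕ} (j : Fin 16) (e : Ex) (σ : Fin 16 → ℕ → ℝ)
    {x : ℕ} (hx : x < n) : (assign j e).sem P n k σ j x = e.eval P n k σ 1 (fun _ => x) := by
  simp [sem, hx]

theorem Cmd.sem_assign_of_ne {P : ℕ → ℕ → ℝ} {n k : ℕ} {j j' : Fin 16} (e : Ex)
    (σ : Fin 16 → ℕ → ℝ) (h : j' ≠ j) : (assign j e).sem P n k σ j' = σ j' := by
  ext x
  simp [sem, h]

/-! ### The algorithm in the array language. -/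

namespace Ex

/-- The smaller one of the budget and the order. -/
def cappedBudget : Ex := .op .add .order (.op .mul (.op .sub .budget .order) (.op .lt .budget .order))

/-- Whether the variable `x` is among the top vertices for the variable `u`, with the weights in the
array `0`. -/
def top (u x : ℕ) : Ex :=
  .op .lt (.op .mul (.op .mul (.const 8) cappedBudget)
    (.fold .add (.op .mul (.cell 0 2) (.op .lt (.prox u x) (.prox u 2))))) (.fold .add (.cell 0 2))

/-- Whether the variable `0` is unserved by the set in the array `1`. -/
def isUnserved : Ex := .op .lt (.fold .add (.op .mul (.cell 1 1) (top 0 1))) (.const 1)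

/-- The number of unserved vertices that the variable `0` can serve. -/
def gain : Ex := .fold .add (.op .mul (.cell 2 1) (top 1 0))

/-- The indicator of the first maximum of the array `j`. -/
def isFirstMax (j : Fin 16) : Ex :=
  .op .lt (.fold .add (.op .add (.op .lt (.cell j 0) (.cell j 1))
    (.op .mul (.op .lt (.idx 1) (.idx 0)) (.op .sub (.const 1) (.op .lt (.cell j 1) (.cell j 0))))))
    (.const 1)

/-- The extension of the set in the array `1` by the vertex in the array `4` if it has a gain. -/
def extended : Ex := .op .max (.cell 1 0) (.op .mul (.cell 4 0) (.op .lt (.const 0) (.cell 3 0)))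

/-- How well the set in the array `1` serves the variable `0`. -/
def service : Ex := .fold .max (.op .mul (.cell 1 1) (.prox 0 1))

/-- By how much a pair fails to be served. -/
def miss (u v : ℕ) : Ex :=
  .op .sub (.const 1) (.op .max (.prox u v) (.op .mul (.cell 5 u) (.cell 5 v)))

/-- The weights, doubled where they would help the pair that the arrays `7` and `9` mark. -/
def doubled : Ex :=
  .op .mul (.cell 0 0) (.op .add (.const 1) (.op .lt (.const 0)
    (.fold .add (.op .mul (.op .add (.cell 7 1) (.cell 9 1)) (.op .lt (.cell 5 1) (.prox 1 0))))))

/-- The array `j` where the array `10` is less than the array `12`, else the array `j'`. -/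
def choose (j j' : Fin 16) : Ex :=
  .op .add (.cell j' 0) (.op .mul (.op .sub (.cell j 0) (.cell j' 0))
    (.op .lt (.cell 10 0) (.cell 12 0)))

end Ex

namespace Cmd

/-- One greedy step for the set in the array `1`. -/
def greedy : Cmd :=
  .seq (.assign 2 .isUnserved) <| .seq (.assign 3 .gain) <| .seq (.assign 4 (.isFirstMax 3)) <|
  .seq (.assign 13 .extended) (.assign 1 (.cell 13 0))

/-- Compute a set of servers. -/
def servers : Cmd := .seq (.assign 1 (.const 0)) (.rep greedy)

/-- Find the pair that is served worst, and compute the new weights. -/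
def reweight : Cmd :=
  .seq (.assign 5 .service) <| .seq (.assign 6 (.fold .max (.miss 0 1))) <|
  .seq (.assign 7 (.isFirstMax 6)) <|
  .seq (.assign 8 (.fold .add (.op .mul (.cell 7 1) (.miss 1 0)))) <|
  .seq (.assign 9 (.isFirstMax 8)) <| .seq (.assign 13 .doubled) <| .seq (.assign 0 (.cell 13 0))
  (.assign 10 (.fold .max (.cell 6 1)))

/-- Keep the best set in the array `11` and the extent of its serviceGap in the array `12`. -/
def keepBest : Cmd :=
  .seq (.assign 13 (.choose 1 11)) <| .seq (.assign 14 (.choose 10 12)) <|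
  .seq (.assign 11 (.cell 13 0)) (.assign 12 (.cell 14 0))

/-- One round of the multiplicative weights method. -/
def round : Cmd := .seq servers (.seq reweight keepBest)

end Cmd

/-! ### The effect of one round on the arrays. -/

section Semantics
variable {P : ℕ → ℕ → ℝ} {n k : ℕ} {σ : Fin 16 → ℕ → ℝ}

theorem Ex.eval_cappedBudget (d : ℕ) (ρ : ℕ → ℕ) :
    Ex.cappedBudget.eval P n k σ d ρ = ((min k n : ℕ) : ℝ) := by
  simp only [cappedBudget, eval, Op.apply, Nat.cast_lt]
  split_ifs with h
  · rw [min_eq_left h.le]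
    ring
  · rw [min_eq_right (not_lt.1 h)]
    ring

theorem Ex.eval_top {u x : ℕ} (hu : u < 2) (hx : x < 2) (ρ : ℕ → ℕ) :
    (Ex.top u x).eval P n k σ 2 ρ = if Top P n (min k n) (σ 0) (ρ u) (ρ x) then 1 else 0 := by
  simp only [top, eval, Op.apply, Op.foldRange_add, eval_cappedBudget, Function.update_self,
    Function.update_of_ne hu.ne, Function.update_of_ne hx.ne]
  simp [Top]

theorem Ex.eval_isFirstMax (j : Fin 16) (x : ℕ) :
    (Ex.isFirstMax j).eval P n k σ 1 (fun _ => x) = firstMax n (σ j) x := by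
  simp [isFirstMax, eval, Op.apply, Op.foldRange_add, firstMax]

theorem Cmd.greedy_sem (hn : 0 < n) {S : Finset ℕ} (hS : S ⊆ Finset.range n)
    (hσ : ∀ x < n, σ 1 x = if x ∈ S then 1 else 0) :
    ∃ S', GreedyStep P n (min k n) (σ 0) S S' ∧
      (∀ x < n, greedy.sem P n k σ 1 x = if x ∈ S' then 1 else 0) ∧
      greedy.sem P n k σ 0 = σ 0 ∧ greedy.sem P n k σ 11 = σ 11 ∧
      greedy.sem P n k σ 12 = σ 12 := by
  set w := σ 0 with hw
  set σ₁ := (assign 2 .isUnserved).sem P n k σ with h1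
  set σ₂ := (assign 3 .gain).sem P n k σ₁ with h2
  set σ₃ := (assign 4 (.isFirstMax 3)).sem P n k σ₂ with h3
  -- The new set passes through the buffer 13, since a valid assignment may not read its own target.
  set σ₄ := (assign 13 .extended).sem P n k σ₃ with h4
  have hsem : greedy.sem P n k σ = (assign 1 (.cell 13 0)).sem P n k σ₄ := rfl
  have u1 : ∀ u < n, σ₁ 2 u = if u ∈ unserved P n (min k n) w S then 1 else 0 := by
    intro u hu
    rw [h1, sem_assign_self _ _ _ hu]
    simp only [Ex.isUnserved, Ex.eval, Op.apply, Op.foldRange_add,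
      Ex.eval_top (show 0 < 2 by omega) (show 1 < 2 by omega), Nat.cast_one]
    have hval : ∑ i ∈ Finset.range n, σ 1 (Function.update (fun _ => u) 1 i 1) *
        (if Top P n (min k n) (σ 0) (Function.update (fun _ => u) 1 i 0)
          (Function.update (fun _ => u) 1 i 1) then 1 else 0) =
        ∑ i ∈ Finset.range n, if i ∈ S ∧ Top P n (min k n) w u i then (1 : ℝ) else 0 := by
      refine Finset.sum_congr rfl fun i hi => ?_
      simp only [Function.update_self, Function.update_of_ne (show (0 : ℕ) ≠ 1 by omega),
        hσ i (Finset.mem_range.1 hi), ← hw]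
      by_cases a : i ∈ S
      · simp [a]
      · simp [a]
    rw [hval, Finset.sum_boole]
    congr 1
    rw [unserved, Finset.mem_filter, Nat.cast_lt_one, Finset.card_eq_zero,
      Finset.filter_eq_empty_iff, eq_iff_iff]
    constructor
    · exact fun h => ⟨Finset.mem_range.2 hu, fun y hy hT => h (hS hy) ⟨hy, hT⟩⟩
    · exact fun h y _ hy => h.2 y hy.1 hy.2
  have u2 : ∀ x < n, σ₂ 3 x =
      (({u ∈ unserved P n (min k n) w S | Top P n (min k n) w u x}).card : ℝ) := by
    intro x hx
    rw [h2, sem_assign_self _ _ _ hx]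
    simp only [Ex.gain, Ex.eval, Op.apply, Op.foldRange_add,
      Ex.eval_top (show 1 < 2 by omega) (show 0 < 2 by omega)]
    rw [← Finset.sum_boole]
    have : unserved P n (min k n) w S ⊆ Finset.range n := Finset.filter_subset _ _
    rw [← Finset.inter_eq_right.2 this, ← Finset.sum_ite_mem]
    refine Finset.sum_congr rfl fun u hu => ?_
    simp only [Function.update_self, Function.update_of_ne (show (0 : ℕ) ≠ 1 by omega),
      u1 u (Finset.mem_range.1 hu)]
    rw [h1, sem_assign_of_ne _ _ (by decide), ← hw]
    split_ifs <;> simp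
  obtain ⟨x₀, hx₀, hmax, hfirst⟩ := exists_firstMax hn (σ₂ 3)
  refine ⟨if 0 < ({u ∈ unserved P n (min k n) w S | Top P n (min k n) w u x₀}).card
    then insert x₀ S else S, ⟨x₀, hx₀, fun x hx => ?_, rfl⟩, fun x hx => ?_, ?_, ?_, ?_⟩
  · have := hmax x hx
    rw [u2 x hx, u2 x₀ hx₀] at this
    exact_mod_cast this
  · rw [hsem, sem_assign_self _ _ _ hx]
    simp only [Ex.eval]
    rw [h4, sem_assign_self _ _ _ hx]
    simp only [Ex.extended, Ex.eval, Op.apply_max]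
    simp only [Op.apply, Nat.cast_zero]
    have a1 : σ₃ 1 x = if x ∈ S then 1 else 0 := by
      rw [h3, sem_assign_of_ne _ _ (by decide), h2, sem_assign_of_ne _ _ (by decide), h1,
        sem_assign_of_ne _ _ (by decide), hσ x hx]
    have a3 : σ₃ 3 x = σ₂ 3 x := by rw [h3, sem_assign_of_ne _ _ (by decide)]
    have a4 : σ₃ 4 x = if x = x₀ then 1 else 0 := by
      rw [h3, sem_assign_self _ _ _ hx, Ex.eval_isFirstMax, hfirst x hx]
    rw [a1, a3, a4]
    have hx3 := u2 x₀ hx₀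
    generalize ({u ∈ unserved P n (min k n) w S | Top P n (min k n) w u x₀}).card = N at hx3 ⊢
    by_cases hxx : x = x₀
    · rw [hxx, hx3]
      rcases Nat.eq_zero_or_pos N with rfl | hN
      · by_cases hxS : x₀ ∈ S <;> simp [hxS]
      · by_cases hxS : x₀ ∈ S <;> simp [hxS, hN]
    · by_cases hN : 0 < N <;> by_cases hxS : x ∈ S <;> simp [hxx, hN, hxS]
  all_goals
    rw [hsem, sem_assign_of_ne _ _ (by decide), h4, sem_assign_of_ne _ _ (by decide), h3,
      sem_assign_of_ne _ _ (by decide), h2, sem_assign_of_ne _ _ (by decide), h1,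
      sem_assign_of_ne _ _ (by decide)]

theorem Cmd.servers_sem (hn : 0 < n) (hk : 0 < k) (hw : ∀ x < n, 0 < σ 0 x) :
    ∃ S, GreedyInv P n (min k n) (σ 0) n S ∧
      (∀ x < n, servers.sem P n k σ 1 x = if x ∈ S then 1 else 0) ∧
      servers.sem P n k σ 0 = σ 0 ∧ servers.sem P n k σ 11 = σ 11 ∧
      servers.sem P n k σ 12 = σ 12 := by
  have key : ∀ i : ℕ, ∃ S, GreedyInv P n (min k n) (σ 0) i S ∧
      (∀ x < n, (greedy.sem P n k)^[i] ((assign 1 (.const 0)).sem P n k σ) 1 x =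
        if x ∈ S then 1 else 0) ∧
      (greedy.sem P n k)^[i] ((assign 1 (.const 0)).sem P n k σ) 0 = σ 0 ∧
      (greedy.sem P n k)^[i] ((assign 1 (.const 0)).sem P n k σ) 11 = σ 11 ∧
      (greedy.sem P n k)^[i] ((assign 1 (.const 0)).sem P n k σ) 12 = σ 12 := by
    intro i
    induction i with
    | zero =>
      refine ⟨∅, .zero, fun x hx => ?_, ?_, ?_, ?_⟩
      · rw [Function.iterate_zero_apply, sem_assign_self _ _ _ hx]
        simp [Ex.eval]
      all_goals rw [Function.iterate_zero_apply, sem_assign_of_ne _ _ (by decide)]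
    | succ i ih =>
      obtain ⟨S, hS, h1, h2, h3, h4⟩ := ih
      obtain ⟨S', hS', h1', h2', h3', h4'⟩ := greedy_sem (P := P) (k := k) hn hS.sub h1
      simp only [Function.iterate_succ_apply']
      rw [h2] at hS'
      exact ⟨S', hS.step hn (by omega) hw hS', h1', h2'.trans h2, h3'.trans h3, h4'.trans h4⟩
  exact key n

/-- How well the set `S` serves `u`. -/
noncomputable def serve (P : ℕ → ℕ → ℝ) (n : ℕ) (S : Finset ℕ) (u : ℕ) : ℝ :=
  Op.max.foldRange (fun y => (if y ∈ S then 1 else 0) * P u y) n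

/-- By how much the set `S` fails to serve the pair of `u` and `v`. -/
noncomputable def serviceGap (P : ℕ → ℕ → ℝ) (n : ℕ) (S : Finset ℕ) (u v : ℕ) : ℝ :=
  1 - max (P u v) (serve P n S u * serve P n S v)

theorem le_serve {S : Finset ℕ} {u y : ℕ} (hy : y < n) (hyS : y ∈ S) : P u y ≤ serve P n S u := by
  calc P u y = (if y ∈ S then 1 else 0) * P u y := by simp [hyS]
    _ ≤ _ := Op.le_foldRange_max (fun y => (if y ∈ S then 1 else 0) * P u y) hy

theorem serve_nonneg (S : Finset ℕ) (u : ℕ) : 0 ≤ serve P n S u := Op.foldRange_max_nonneg _ _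

theorem serve_le_one (h1 : ∀ u v, P u v ≤ 1) (S : Finset ℕ) (u : ℕ) : serve P n S u ≤ 1 := by
  refine (Op.foldRange_max_le_iff _ _ _).2 ⟨zero_le_one, fun i _ => ?_⟩
  split_ifs
  · simpa using h1 u i
  · simp

/-- Positivity excludes both the initial value `0` of the fold and the terms outside `S`. -/
theorem exists_of_serve_pos {S : Finset ℕ} {u : ℕ} (h : 0 < serve P n S u) :
    ∃ y ∈ S, y < n ∧ serve P n S u = P u y := by
  rcases Op.foldRange_max_eq (fun y => (if y ∈ S then 1 else 0) * P u y) n with h0 | ⟨y, hy, h0⟩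
  · exact absurd h0 h.ne'
  · change serve P n S u = _ at h0
    by_cases hyS : y ∈ S
    · exact ⟨y, hyS, hy, by simpa [hyS] using h0⟩
    · rw [if_neg hyS, zero_mul] at h0
      exact absurd h0 h.ne'

/-- Since gaps are nonnegative, a maximum fold that starts at `0` computes the worst gap exactly; a
minimum of the service would not be available in this way. -/
theorem serviceGap_nonneg (h1 : ∀ u v, P u v ≤ 1) (S : Finset ℕ) (u v : ℕ) :
    0 ≤ serviceGap P n S u v :=
  sub_nonneg.2 (max_le (h1 u v) (mul_le_one₀ (serve_le_one h1 S u) (serve_nonneg S v)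
    (serve_le_one h1 S v)))

theorem Op.foldRange_max_of_isMax {f : ℕ → ℝ} {m i : ℕ} (hi : i < m) (h0 : 0 ≤ f i)
    (h : ∀ j < m, f j ≤ f i) : Op.max.foldRange f m = f i :=
  le_antisymm ((Op.foldRange_max_le_iff _ _ _).2 ⟨h0, h⟩) (Op.le_foldRange_max f hi)

/-- A worst pair is found in two stages with one-dimensional arrays: `u` maximises the row maxima of
the gap, then `v` maximises the row of `u`. -/
theorem Cmd.reweight_sem (hn : 0 < n) (h1 : ∀ u v, P u v ≤ 1) {S : Finset ℕ}
    (hS : ∀ x < n, σ 1 x = if x ∈ S then 1 else 0) :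
    ∃ u < n, ∃ v < n, (∀ u' < n, ∀ v' < n, serviceGap P n S u' v' ≤ serviceGap P n S u v) ∧
      (∀ x < n, reweight.sem P n k σ 0 x = σ 0 x *
        (1 + if serve P n S u < P u x ∨ serve P n S v < P v x then 1 else 0)) ∧
      (∀ x < n, reweight.sem P n k σ 10 x = serviceGap P n S u v) ∧
      reweight.sem P n k σ 1 = σ 1 ∧ reweight.sem P n k σ 11 = σ 11 ∧
      reweight.sem P n k σ 12 = σ 12 := by
  set σ₁ := (assign 5 .service).sem P n k σ with d1
  set σ₂ := (assign 6 (.fold .max (.miss 0 1))).sem P n k σ₁ with d2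
  set σ₃ := (assign 7 (.isFirstMax 6)).sem P n k σ₂ with d3
  set σ₄ := (assign 8 (.fold .add (.op .mul (.cell 7 1) (.miss 1 0)))).sem P n k σ₃ with d4
  set σ₅ := (assign 9 (.isFirstMax 8)).sem P n k σ₄ with d5
  set σ₆ := (assign 13 .doubled).sem P n k σ₅ with d6
  set σ₇ := (assign 0 (.cell 13 0)).sem P n k σ₆ with d7
  have hsem : reweight.sem P n k σ = (assign 10 (.fold .max (.cell 6 1))).sem P n k σ₇ := rfl
  have e1 : ∀ u < n, σ₁ 5 u = serve P n S u := by
    intro u hu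
    rw [d1, sem_assign_self _ _ _ hu]
    simp only [Ex.service, Ex.eval]
    refine Op.foldRange_congr _ fun y hy => ?_
    simp [Op.apply, hS y hy]
  have e2 : ∀ u < n, σ₂ 6 u = Op.max.foldRange (serviceGap P n S u) n := by
    intro u hu
    rw [d2, sem_assign_self _ _ _ hu]
    simp only [Ex.miss, Ex.eval, Op.apply_max]
    refine Op.foldRange_congr _ fun v hv => ?_
    simp [Op.apply, e1 u hu, e1 v hv, serviceGap]
  obtain ⟨u, hu, humax, hufirst⟩ := exists_firstMax hn (σ₂ 6)
  have e3 : ∀ x < n, σ₃ 7 x = if x = u then 1 else 0 := by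
    intro x hx
    rw [d3, sem_assign_self _ _ _ hx, Ex.eval_isFirstMax, hufirst x hx]
  have f5 : ∀ x < n, σ₃ 5 x = serve P n S x := by
    intro x hx
    rw [d3, sem_assign_of_ne _ _ (by decide), d2, sem_assign_of_ne _ _ (by decide), e1 x hx]
  have e4 : ∀ v < n, σ₄ 8 v = serviceGap P n S u v := by
    intro v hv
    rw [d4, sem_assign_self _ _ _ hv]
    simp only [Ex.miss, Ex.eval, Op.apply_max, Op.foldRange_add]
    simp only [Op.apply]
    rw [Finset.sum_eq_single_of_mem u (Finset.mem_range.2 hu)]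
    · simp [e3 u hu, f5 u hu, f5 v hv, serviceGap]
    · intro x hx hxu
      simp [e3 x (Finset.mem_range.1 hx), hxu]
  obtain ⟨v, hv, hvmax, hvfirst⟩ := exists_firstMax hn (σ₄ 8)
  have e5 : ∀ x < n, σ₅ 9 x = if x = v then 1 else 0 := by
    intro x hx
    rw [d5, sem_assign_self _ _ _ hx, Ex.eval_isFirstMax, hvfirst x hx]
  have hrow : Op.max.foldRange (serviceGap P n S u) n = serviceGap P n S u v := by
    refine Op.foldRange_max_of_isMax hv (serviceGap_nonneg h1 S u v) fun v' hv' => ?_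
    rw [← e4 v' hv', ← e4 v hv]
    exact hvmax v' hv'
  refine ⟨u, hu, v, hv, fun u' hu' v' hv' => ?_, fun x hx => ?_, fun x hx => ?_, ?_, ?_, ?_⟩
  · rw [← hrow, ← e2 u hu]
    refine le_trans ?_ (humax u' hu')
    rw [e2 u' hu']
    exact Op.le_foldRange_max (serviceGap P n S u') hv'
  · rw [hsem, sem_assign_of_ne _ _ (by decide), d7, sem_assign_self _ _ _ hx]
    simp only [Ex.eval]
    rw [d6, sem_assign_self _ _ _ hx]
    have g0 : σ₅ 0 = σ 0 := by
      rw [d5, sem_assign_of_ne _ _ (by decide), d4, sem_assign_of_ne _ _ (by decide), d3,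
        sem_assign_of_ne _ _ (by decide), d2, sem_assign_of_ne _ _ (by decide), d1,
        sem_assign_of_ne _ _ (by decide)]
    have g5 : σ₅ 5 = σ₃ 5 := by
      rw [d5, sem_assign_of_ne _ _ (by decide), d4, sem_assign_of_ne _ _ (by decide)]
    have g7 : σ₅ 7 = σ₃ 7 := by
      rw [d5, sem_assign_of_ne _ _ (by decide), d4, sem_assign_of_ne _ _ (by decide)]
    simp only [Ex.doubled, Ex.eval, Op.foldRange_add]
    simp only [Op.apply, g0, g5, g7]
    have hsum : ∑ y ∈ Finset.range n, (σ₃ 7 y + σ₅ 9 y) * (if σ₃ 5 y < P y x then 1 else 0) =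
        (if serve P n S u < P u x then 1 else 0) + if serve P n S v < P v x then (1 : ℝ) else 0 := by
      simp only [add_mul, Finset.sum_add_distrib]
      rw [Finset.sum_eq_single_of_mem u (Finset.mem_range.2 hu),
        Finset.sum_eq_single_of_mem v (Finset.mem_range.2 hv)]
      · simp [e3 u hu, e5 v hv, f5 u hu, f5 v hv]
      · intro y hy hyv
        simp [e5 y (Finset.mem_range.1 hy), hyv]
      · intro y hy hyu
        simp [e3 y (Finset.mem_range.1 hy), hyu]
    simp only [Function.update_self, Function.update_of_ne (show (0 : ℕ) ≠ 1 by omega)]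
    rw [hsum]
    congr 1
    -- The test `0 < _` turns a count of one or two into one, so a weight is never more than
    -- doubled.
    by_cases a : serve P n S u < P u x <;> by_cases b : serve P n S v < P v x <;> simp [a, b]
  · rw [hsem, sem_assign_self _ _ _ hx]
    simp only [Ex.eval]
    have g6 : σ₇ 6 = σ₂ 6 := by
      rw [d7, sem_assign_of_ne _ _ (by decide), d6, sem_assign_of_ne _ _ (by decide), d5,
        sem_assign_of_ne _ _ (by decide), d4, sem_assign_of_ne _ _ (by decide), d3,
        sem_assign_of_ne _ _ (by decide)]
    simp only [g6, Function.update_self]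
    have hu6 : σ₂ 6 u = serviceGap P n S u v := by rw [e2 u hu, hrow]
    rw [← hu6]
    exact Op.foldRange_max_of_isMax hu (by rw [hu6]; exact serviceGap_nonneg h1 S u v) humax
  all_goals
    rw [hsem, sem_assign_of_ne _ _ (by decide), d7, sem_assign_of_ne _ _ (by decide), d6,
      sem_assign_of_ne _ _ (by decide), d5, sem_assign_of_ne _ _ (by decide), d4,
      sem_assign_of_ne _ _ (by decide), d3, sem_assign_of_ne _ _ (by decide), d2,
      sem_assign_of_ne _ _ (by decide), d1, sem_assign_of_ne _ _ (by decide)]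

theorem Ex.eval_choose (j j' : Fin 16) (x : ℕ) : (Ex.choose j j').eval P n k σ 1 (fun _ => x) =
    if σ 10 x < σ 12 x then σ j x else σ j' x := by
  simp only [choose, eval, Op.apply]
  by_cases h : σ 10 x < σ 12 x <;> simp [h]

theorem Cmd.keepBest_sem {x : ℕ} (hx : x < n) :
    keepBest.sem P n k σ 0 x = σ 0 x ∧
    keepBest.sem P n k σ 11 x = (if σ 10 x < σ 12 x then σ 1 x else σ 11 x) ∧
    keepBest.sem P n k σ 12 x = if σ 10 x < σ 12 x then σ 10 x else σ 12 x := by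
  set σ₁ := (assign 13 (.choose 1 11)).sem P n k σ with d1
  set σ₂ := (assign 14 (.choose 10 12)).sem P n k σ₁ with d2
  set σ₃ := (assign 11 (.cell 13 0)).sem P n k σ₂ with d3
  have hsem : keepBest.sem P n k σ = (assign 12 (.cell 14 0)).sem P n k σ₃ := rfl
  have g : ∀ j, j ≠ 13 → σ₁ j = σ j := fun j hj => by rw [d1, sem_assign_of_ne _ _ hj]
  refine ⟨?_, ?_, ?_⟩
  · rw [hsem, sem_assign_of_ne _ _ (by decide), d3, sem_assign_of_ne _ _ (by decide), d2,
      sem_assign_of_ne _ _ (by decide), g 0 (by decide)]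
  · rw [hsem, sem_assign_of_ne _ _ (by decide), d3, sem_assign_self _ _ _ hx]
    simp only [Ex.eval]
    rw [d2, sem_assign_of_ne _ _ (by decide), d1, sem_assign_self _ _ _ hx, Ex.eval_choose]
  · rw [hsem, sem_assign_self _ _ _ hx]
    simp only [Ex.eval]
    rw [d3, sem_assign_of_ne _ _ (by decide), d2, sem_assign_self _ _ _ hx, Ex.eval_choose,
      g 10 (by decide), g 12 (by decide)]

/-- The effect of a round. -/
theorem Cmd.round_sem (hn : 0 < n) (hk : 0 < k) (h1 : ∀ u v, P u v ≤ 1)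
    (hw : ∀ x < n, 0 < σ 0 x) :
    ∃ S, GreedyInv P n (min k n) (σ 0) n S ∧ ∃ u < n, ∃ v < n,
      (∀ u' < n, ∀ v' < n, serviceGap P n S u' v' ≤ serviceGap P n S u v) ∧ ∀ x < n,
      round.sem P n k σ 0 x = σ 0 x *
        (1 + if serve P n S u < P u x ∨ serve P n S v < P v x then 1 else 0) ∧
      round.sem P n k σ 11 x =
        (if serviceGap P n S u v < σ 12 x then if x ∈ S then 1 else 0 else σ 11 x) ∧
      round.sem P n k σ 12 x =
        if serviceGap P n S u v < σ 12 x then serviceGap P n S u v else σ 12 x := by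
  obtain ⟨S, hS, a1, a0, a11, a12⟩ := servers_sem (P := P) hn hk hw
  obtain ⟨u, hu, v, hv, hmax, b0, b10, b1, b11, b12⟩ := reweight_sem (P := P) (k := k) hn h1 a1
  refine ⟨S, hS, u, hu, v, hv, hmax, fun x hx => ?_⟩
  obtain ⟨c0, c11, c12⟩ := keepBest_sem (P := P) (k := k)
    (σ := reweight.sem P n k (servers.sem P n k σ)) hx
  rw [b0 x hx, a0] at c0
  rw [b10 x hx, b12, a12, b1, a1 x hx, b11, a11] at c11
  rw [b10 x hx, b12, a12] at c12
  exact ⟨c0, c11, c12⟩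

end Semantics

/-! ### The potential argument for multiplicative weights. -/

section MultiplicativeWeights
variable {P : ℕ → ℕ → ℝ} {n k : ℕ} {B : ℝ} {X : Finset ℕ}

/-- What holds after `t` rounds, if the hubs `X` serve all pairs to the extent `B`. -/
structure RoundInv (P : ℕ → ℕ → ℝ) (n κ : ℕ) (B : ℝ) (X : Finset ℕ) (t : ℕ)
    (σ : Fin 16 → ℕ → ℝ) : Prop where
  one_le : ∀ x < n, 1 ≤ σ 0 x
  total : ∑ x ∈ Finset.range n, σ 0 x ≤ n * (1 + 1 / (4 * (κ : ℝ))) ^ t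
  best : ∃ (S : Finset ℕ) (L : ℝ), (S.card : ℝ) ≤ 8 * κ * Real.log n + 1 ∧
    (∀ x < n, σ 11 x = if x ∈ S then 1 else 0) ∧ (∀ x < n, σ 12 x = L) ∧
    (∀ u < n, ∀ v < n, serviceGap P n S u v ≤ L) ∧ (L ≤ 1 - B ∨ 2 ^ t ≤ ∏ x ∈ X, σ 0 x)

/-- `S` contains a vertex that is top for `u`, and whatever is closer to `u` than `S` is closer than
that vertex. -/
theorem mass_lt_of_top {κ : ℕ} {w : ℕ → ℝ} (hw : ∀ x < n, 0 < w x) {S : Finset ℕ}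
    (hS : GreedyInv P n κ w n S) {u : ℕ} (hu : u < n) :
    8 * (κ : ℝ) * ∑ x ∈ Finset.range n, w x * (if serve P n S u < P u x then 1 else 0) <
      ∑ x ∈ Finset.range n, w x := by
  obtain ⟨y, hy, hT⟩ := hS.exists_top hu
  refine lt_of_le_of_lt (mul_le_mul_of_nonneg_left (Finset.sum_le_sum fun x hx => ?_)
    (by positivity)) hT
  refine mul_le_mul_of_nonneg_left ?_ (hw x (Finset.mem_range.1 hx)).le
  have := le_serve (P := P) (u := u) (Finset.mem_range.1 (hS.sub hy)) hy
  by_cases h : serve P n S u < P u x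
  · rw [if_pos h, if_pos (this.trans_lt h)]
  · rw [if_neg h]
    split_ifs <;> norm_num

/-- The product of the hub weights is the potential: unless a set of level `B` has been recorded,
every round so far has failed, and each failure doubles at least one hub. -/
theorem RoundInv.step (hn : 0 < n) (hk : 0 < k) (h0 : ∀ u v, 0 ≤ P u v) (h1 : ∀ u v, P u v ≤ 1)
    (hX : X ⊆ Finset.range n)
    (hB : ∀ u < n, ∀ v < n, B ≤ P u v ∨ ∃ x ∈ X, ∃ y ∈ X, B ≤ P u x * P v y)
    {t : ℕ} {σ : Fin 16 → ℕ → ℝ} (h : RoundInv P n (min k n) B X t σ) :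
    RoundInv P n (min k n) B X (t + 1) (Cmd.round.sem P n k σ) := by
  have hw : ∀ x < n, 0 < σ 0 x := fun x hx => one_pos.trans_le (h.one_le x hx)
  obtain ⟨S, hS, u, hu, v, hv, hmax, hround⟩ := Cmd.round_sem (P := P) hn hk h1 hw
  obtain ⟨S₀, L, hcard, h11, h12, hL, hor⟩ := h.best
  have hκ : 0 < min k n := by omega
  set κ := min k n
  have hκ' : (0 : ℝ) < κ := by exact_mod_cast hκ
  set I : ℕ → ℝ := fun x => if serve P n S u < P u x ∨ serve P n S v < P v x then 1 else 0 with hI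
  have hI0 : ∀ x, 0 ≤ I x := fun x => by
    simp only [hI]
    split_ifs <;> norm_num
  refine ⟨fun x hx => ?_, ?_, ?_⟩
  · rw [(hround x hx).1]
    have := h.one_le x hx
    nlinarith [hI0 x]
  · have e1 := mass_lt_of_top hw hS hu
    have e2 := mass_lt_of_top hw hS hv
    have e3 : ∑ x ∈ Finset.range n, Cmd.round.sem P n k σ 0 x ≤ ∑ x ∈ Finset.range n, σ 0 x +
        (∑ x ∈ Finset.range n, σ 0 x * (if serve P n S u < P u x then 1 else 0) +
        ∑ x ∈ Finset.range n, σ 0 x * (if serve P n S v < P v x then 1 else 0)) := by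
      rw [← Finset.sum_add_distrib, ← Finset.sum_add_distrib]
      refine Finset.sum_le_sum fun x hx => ?_
      rw [(hround x (Finset.mem_range.1 hx)).1, mul_add, mul_one, ← mul_add]
      have := hw x (Finset.mem_range.1 hx)
      refine add_le_add le_rfl (mul_le_mul_of_nonneg_left ?_ this.le)
      by_cases a : serve P n S u < P u x <;> by_cases b : serve P n S v < P v x <;> simp [a, b]
    have e4 := h.total
    rw [pow_succ, ← mul_assoc]
    refine le_trans ?_ (mul_le_mul_of_nonneg_right e4 (by positivity))
    refine e3.trans ?_
    set W := ∑ x ∈ Finset.range n, σ 0 x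
    set M₁ := ∑ x ∈ Finset.range n, σ 0 x * (if serve P n S u < P u x then 1 else 0)
    set M₂ := ∑ x ∈ Finset.range n, σ 0 x * (if serve P n S v < P v x then 1 else 0)
    -- The two ends of the pair contribute less than `W / (8κ)` each.
    have : M₁ + M₂ ≤ W * (1 / (4 * (κ : ℝ))) := by
      rw [mul_one_div, le_div_iff₀ (by positivity)]
      linarith
    linarith
  · have hdouble : ¬ serviceGap P n S u v ≤ 1 - B → 2 ^ t ≤ ∏ x ∈ X, σ 0 x →
        2 ^ (t + 1) ≤ ∏ x ∈ X, Cmd.round.sem P n k σ 0 x := by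
      intro hfail hpow
      -- If no hub were closer than `S` to `u` or to `v`, the service of `S` would dominate the hub
      -- product that is at least `B`, and the pair would be served.
      obtain ⟨z, hz, hIz⟩ : ∃ z ∈ X, I z = 1 := by
        have hlt : max (P u v) (serve P n S u * serve P n S v) < B := by
          rw [serviceGap] at hfail
          linarith
        obtain ⟨hlt1, hlt2⟩ := max_lt_iff.1 hlt
        obtain ⟨x, hx, y, hy, hxy⟩ := (hB u hu v hv).resolve_left (not_le.2 hlt1)
        by_contra! hcon
        have hno : ∀ z ∈ X, P u z ≤ serve P n S u ∧ P v z ≤ serve P n S v := by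
          intro z hz
          have := hcon z hz
          simp only [hI] at this
          by_contra hor
          rw [not_and_or, not_le, not_le] at hor
          exact this (if_pos hor)
        have := mul_le_mul (hno x hx).1 (hno y hy).2 (h0 v y) (serve_nonneg S u)
        linarith
      have e1 : ∏ x ∈ X, Cmd.round.sem P n k σ 0 x = (∏ x ∈ X, σ 0 x) * ∏ x ∈ X, (1 + I x) := by
        rw [← Finset.prod_mul_distrib]
        exact Finset.prod_congr rfl fun x hx => (hround x (Finset.mem_range.1 (hX hx))).1
      have e2 : (2 : ℝ) ≤ ∏ x ∈ X, (1 + I x) := by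
        have : ∏ x ∈ X, (if x = z then (2 : ℝ) else 1) = 2 := by
          rw [Finset.prod_ite_eq' X z fun _ => (2 : ℝ), if_pos hz]
        rw [← this]
        refine Finset.prod_le_prod (fun x _ => by split_ifs <;> norm_num) fun x _ => ?_
        split_ifs with hxz
        · rw [hxz, hIz]
          norm_num
        · linarith [hI0 x]
      rw [e1, pow_succ]
      exact mul_le_mul hpow e2 (by norm_num) (le_trans (by positivity) hpow)
    by_cases hlt : serviceGap P n S u v < L
    · refine ⟨S, serviceGap P n S u v, hS.card_le hn hκ, fun x hx => ?_, fun x hx => ?_, hmax, ?_⟩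
      · rw [(hround x hx).2.1, h12 x hx, if_pos hlt]
      · rw [(hround x hx).2.2, h12 x hx, if_pos hlt]
      · by_cases hfail : serviceGap P n S u v ≤ 1 - B
        · exact Or.inl hfail
        · exact Or.inr (hdouble hfail (hor.resolve_left fun h => hfail (hlt.le.trans h)))
    · refine ⟨S₀, L, hcard, fun x hx => ?_, fun x hx => ?_, hL, ?_⟩
      · rw [(hround x hx).2.1, h12 x hx, if_neg hlt, h11 x hx]
      · rw [(hround x hx).2.2, h12 x hx, if_neg hlt]
      · by_cases hfail : serviceGap P n S u v ≤ 1 - B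
        · exact Or.inl ((not_lt.1 hlt).trans hfail)
        · exact hor.imp id (hdouble hfail)

/-- Otherwise `2 ^ t ≤ W ^ (2κ) ≤ n ^ (2κ) * exp (t / 2)` for `t = 8n²`. Since `κ ≤ n`, the right
side is at most `n ^ (2n) * exp (4n²)`, which is too small. -/
theorem RoundInv.le (hn : 0 < n) (hk : 0 < k) (hX : X ⊆ Finset.range n)
    (hcard : X.card ≤ 2 * min k n) {σ : Fin 16 → ℕ → ℝ}
    (h : RoundInv P n (min k n) B X (8 * n * n) σ) :
    ∃ S : Finset ℕ, (S.card : ℝ) ≤ 8 * (min k n : ℕ) * Real.log n + 1 ∧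
      (∀ x < n, σ 11 x = if x ∈ S then 1 else 0) ∧
      ∀ u < n, ∀ v < n, serviceGap P n S u v ≤ 1 - B := by
  obtain ⟨S, L, hS, h11, -, hL, hor⟩ := h.best
  refine ⟨S, hS, h11, fun u hu v hv => (hL u hu v hv).trans (hor.resolve_right fun hpow => ?_)⟩
  have hκ : 0 < min k n := by omega
  have hκn : min k n ≤ n := min_le_right _ _
  set κ := min k n
  have hκ' : (0 : ℝ) < κ := by exact_mod_cast hκ
  set W := ∑ x ∈ Finset.range n, σ 0 x with hW
  have hle : ∀ x < n, σ 0 x ≤ W := fun x hx => Finset.single_le_sum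
    (fun y hy => zero_le_one.trans (h.one_le y (Finset.mem_range.1 hy))) (Finset.mem_range.2 hx)
  have hW1 : 1 ≤ W := (h.one_le 0 hn).trans (hle 0 hn)
  have hn1 : (1 : ℝ) ≤ n := by exact_mod_cast hn
  have e1 : ∏ x ∈ X, σ 0 x ≤ W ^ (2 * κ) := by
    refine (Finset.prod_le_prod (fun x hx => ?_) fun x hx =>
      hle x (Finset.mem_range.1 (hX hx))).trans ?_
    · exact zero_le_one.trans (h.one_le x (Finset.mem_range.1 (hX hx)))
    · rw [Finset.prod_const]
      exact pow_le_pow_right₀ hW1 hcard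
  have e2 : (1 + 1 / (4 * (κ : ℝ))) ^ (8 * n * n * (2 * κ)) ≤ 64 ^ (n * n) := by
    have : 1 + 1 / (4 * (κ : ℝ)) ≤ Real.exp (1 / (4 * κ)) := by
      rw [add_comm]
      exact Real.add_one_le_exp _
    refine (pow_le_pow_left₀ (by positivity) this _).trans ?_
    rw [← Real.exp_nat_mul]
    have : ((8 * n * n * (2 * κ) : ℕ) : ℝ) * (1 / (4 * κ)) = ((n * n : ℕ) : ℝ) * 4 := by
      push_cast
      field_simp
      norm_num
    rw [this, Real.exp_nat_mul]
    refine pow_le_pow_left₀ (Real.exp_pos _).le ?_ _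
    have h4 : Real.exp 4 = Real.exp 1 ^ 4 := by
      rw [← Real.exp_nat_mul]
      norm_num
    rw [h4]
    refine (pow_le_pow_left₀ (Real.exp_pos _).le Real.exp_one_lt_d9.le 4).trans ?_
    norm_num
  have e3 : W ^ (2 * κ) ≤ (n : ℝ) ^ (2 * n) * 64 ^ (n * n) := by
    refine (pow_le_pow_left₀ (zero_le_one.trans hW1) h.total _).trans ?_
    rw [mul_pow, ← pow_mul]
    exact mul_le_mul (pow_le_pow_right₀ hn1 (by omega)) e2 (by positivity) (by positivity)
  -- The exponent splits as `2n² + 6n²`: the first part beats `n ^ (2n)`, the second pays for `exp 4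
  -- ≤ 64`.
  have e4 : (2 : ℝ) ^ (8 * n * n) = (2 ^ n) ^ (2 * n) * 64 ^ (n * n) := by
    rw [show (64 : ℝ) = 2 ^ 6 by norm_num, ← pow_mul, ← pow_mul, ← pow_add]
    congr 1
    ring
  have e5 : (n : ℝ) ^ (2 * n) < (2 ^ n) ^ (2 * n) :=
    pow_lt_pow_left₀ (by exact_mod_cast Nat.lt_two_pow_self) (by positivity) (by omega)
  have e6 : (0 : ℝ) < 64 ^ (n * n) := by positivity
  have := (hpow.trans e1).trans e3
  rw [e4] at this
  exact absurd (le_of_mul_le_mul_right this e6) (not_le.2 e5)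

end MultiplicativeWeights

/-! ### The complete algorithm and its guarantee. -/

/-- The algorithm: at least `8n²` rounds from equal weights; the hubs end up in the array `14`. -/
def Cmd.hubs : Cmd :=
  .seq (.seq (.assign 0 (.const 1)) (.assign 12 (.const 2))) <|
  .seq (.rep (.rep (.seq (.seq (.seq round round) (.seq round round))
    (.seq (.seq round round) (.seq round round)))))
  (.assign 14 (.op .mul (.op .lt (.const 0) .budget) (.cell 11 0)))

theorem Cmd.hubs_valid : hubs.Valid := by
  simp [hubs, round, servers, reweight, keepBest, greedy, Valid, Ex.Scoped, Ex.Avoids,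
    Ex.isUnserved, Ex.gain, Ex.isFirstMax, Ex.extended, Ex.service, Ex.miss, Ex.doubled, Ex.choose,
    Ex.top, Ex.cappedBudget]

/-- Without budget no edge may be added, and the analysis of the rounds needs `κ > 0`; the factor `0
< budget` clears whatever they produced. -/
theorem Cmd.hubs_sem_zero {P : ℕ → ℕ → ℝ} {n x : ℕ} (hx : x < n) (σ : Fin 16 → ℕ → ℝ) :
    hubs.sem P n 0 σ 14 x = 0 := by
  have : ∃ σ', hubs.sem P n 0 σ = (assign 14
    (.op .mul (.op .lt (.const 0) .budget) (.cell 11 0))).sem P n 0 σ' := ⟨_, rfl⟩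
  obtain ⟨σ', h⟩ := this
  rw [h, sem_assign_self _ _ _ hx]
  simp [Ex.eval, Op.apply]

theorem Cmd.hubs_sem {P : ℕ → ℕ → ℝ} {n k : ℕ} (hn : 0 < n) (hk : 0 < k) (h0 : ∀ u v, 0 ≤ P u v)
    (h1 : ∀ u v, P u v ≤ 1) {B : ℝ} {X : Finset ℕ} (hX : X ⊆ Finset.range n)
    (hcard : X.card ≤ 2 * min k n)
    (hB : ∀ u < n, ∀ v < n, B ≤ P u v ∨ ∃ x ∈ X, ∃ y ∈ X, B ≤ P u x * P v y) :
    ∃ S : Finset ℕ, (S.card : ℝ) ≤ 8 * (min k n : ℕ) * Real.log n + 1 ∧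
      (∀ x < n, hubs.sem P n k (fun _ _ => 0) 14 x = if x ∈ S then 1 else 0) ∧
      ∀ u < n, ∀ v < n, serviceGap P n S u v ≤ 1 - B := by
  set σ₀ := (assign 12 (.const 2)).sem P n k ((assign 0 (.const 1)).sem P n k (fun _ _ => 0))
    with hσ₀
  -- The initial record `2` exceeds every gap, so the empty set that it stands for is replaced in
  -- the first round.
  have hinit : RoundInv P n (min k n) B X 0 σ₀ := by
    have hw : ∀ x < n, σ₀ 0 x = 1 := fun x hx => by
      rw [hσ₀, sem_assign_of_ne _ _ (by decide), sem_assign_self _ _ _ hx]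
      simp [Ex.eval]
    refine ⟨fun x hx => (hw x hx).ge, ?_, ∅, 2, ?_, fun x hx => ?_, fun x hx => ?_,
      fun u _ v _ => ?_, Or.inr ?_⟩
    · rw [Finset.sum_congr rfl fun x hx => hw x (Finset.mem_range.1 hx)]
      simp
    · have : 0 ≤ Real.log n := Real.log_natCast_nonneg n
      rw [Finset.card_empty, Nat.cast_zero]
      positivity
    · rw [hσ₀, sem_assign_of_ne _ _ (by decide), sem_assign_of_ne _ _ (by decide)]
      simp
    · rw [hσ₀, sem_assign_self _ _ _ hx]
      simp [Ex.eval]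
    · have := (h0 u v).trans (le_max_left _ (serve P n ∅ u * serve P n ∅ v))
      rw [serviceGap]
      linarith
    · rw [Finset.prod_congr rfl fun x hx => hw x (Finset.mem_range.1 (hX hx))]
      simp
  have hiter : ∀ t, RoundInv P n (min k n) B X t ((round.sem P n k)^[t] σ₀) := by
    intro t
    induction t with
    | zero => exact hinit
    | succ t ih =>
      rw [Function.iterate_succ_apply']
      exact ih.step hn hk h0 h1 hX hB
  obtain ⟨S, hS, h11, hfail⟩ := (hiter (8 * n * n)).le hn hk hX hcard
  refine ⟨S, hS, fun x hx => ?_, hfail⟩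
  -- Repetition is always `n`-fold, so eight copies of the round in two nested repetitions make
  -- `8n²` rounds.
  have hsem : hubs.sem P n k (fun _ _ => 0) =
      (assign 14 (.op .mul (.op .lt (.const 0) .budget) (.cell 11 0))).sem P n k
        ((((round.sem P n k)^[8])^[n])^[n] σ₀) := rfl
  rw [hsem, sem_assign_self _ _ _ hx, ← Function.iterate_mul, ← Function.iterate_mul]
  rw [← mul_assoc]
  simp [Ex.eval, Op.apply, h11 x hx, hk]

/-- The number of hubs in terms of the binary logarithm. -/
theorem hub_bound {n k : ℕ} (hn : 2 ≤ n) (hk : 0 < k) :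
    8 * (min k n : ℕ) * Real.log n + 1 ≤ 9 * k * Real.logb 2 n := by
  have hn' : (2 : ℝ) ≤ n := by exact_mod_cast hn
  have hk' : (1 : ℝ) ≤ k := by exact_mod_cast hk
  have hmin : ((min k n : ℕ) : ℝ) ≤ k := by exact_mod_cast min_le_left k n
  -- This absorbs the summand `1` and raises the constant from 8 to 9.
  have h1 : 1 ≤ Real.logb 2 n := by
    rw [Real.le_logb_iff_rpow_le one_lt_two (by linarith)]
    simpa using hn'
  have h2 : Real.log n ≤ Real.logb 2 n := by
    rw [Real.logb, le_div_iff₀ (Real.log_pos one_lt_two)]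
    have : Real.log 2 ≤ 1 := Real.log_two_lt_d9.le.trans (by norm_num)
    exact mul_le_of_le_one_right (Real.log_natCast_nonneg n) this
  have h3 : 8 * ((min k n : ℕ) : ℝ) * Real.log n ≤ 8 * k * Real.logb 2 n :=
    mul_le_mul (by linarith) h2 (Real.log_natCast_nonneg n) (by positivity)
  nlinarith

end BroadcastImprovement

open BroadcastImprovement in
theorem mainTheorem3 (ε : ℝ) (hε : 0 < ε) :
    ∃ C : ℝ, ∀ α : ℝ, 0 < α → α ≤ 1 →
      ∃ (P : Program) (p : Polynomial ℕ),
        ∀ (n k : ℕ) (G : SimpleGraph (Fin n)), G.Connected →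
          ∃ (t : ℕ) (s : Store n),
            Exec G α P (Store.init n k α) t s ∧
            t ≤ p.eval n ∧
            (∀ e ∈ s.edges, e ∈ Gᶜ.edgeSet) ∧
            (s.edges.card : ℝ) ≤ C * k * Real.logb 2 n ∧
            optBroadcast G α k * α ^ (2 + ε) / ((1 + ε) * (24 * (k : ℝ) ^ 2 + 6)) ≤
              broadcast (addEdges G s.edges) α := by
  obtain ⟨P, p, hP⟩ := Cmd.exists_program Cmd.hubs Cmd.hubs_valid 14
  -- One program and the constant 9 serve all `ε` and `α`.
  refine ⟨9, fun α h0 h1 => ⟨P, p, fun n k G hG => ?_⟩⟩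
  obtain ⟨t, s, hrun, ht, hs⟩ := hP n k G α
  have hn : 0 < n := Fin.pos_iff_nonempty.2 hG.nonempty
  have hopt := optBroadcast_nonneg h0.le h1 G k
  -- What is proved is the stronger `α² β* / (4k² + 1)`; note `24k² + 6 = 6 (4k² + 1)`.
  have htarget : optBroadcast G α k * α ^ (2 + ε) / ((1 + ε) * (24 * (k : ℝ) ^ 2 + 6)) ≤
      α ^ 2 * (optBroadcast G α k / (4 * (k : ℝ) ^ 2 + 1)) := by
    have hα : α ^ (2 + ε) ≤ α ^ 2 := by
      rw [← Real.rpow_natCast α 2]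
      exact Real.rpow_le_rpow_of_exponent_ge h0 h1 (by push_cast; linarith)
    have hden : 4 * (k : ℝ) ^ 2 + 1 ≤ (1 + ε) * (24 * (k : ℝ) ^ 2 + 6) := by
      nlinarith [sq_nonneg (k : ℝ), mul_nonneg hε.le (sq_nonneg (k : ℝ))]
    rw [← mul_div_assoc, mul_comm (α ^ 2)]
    exact div_le_div₀ (by positivity) (mul_le_mul_of_nonneg_left hα hopt) (by positivity) hden
  refine ⟨t, s, hrun, ht, fun e he => ?_, ?_⟩
  · obtain ⟨x, y, -, hyx, hadj, -, rfl⟩ := (hs e).1 he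
    simpa [SimpleGraph.compl_adj] using ⟨hyx.symm, hadj⟩
  rcases Nat.eq_zero_or_pos k with rfl | hk
  · have hempty : s.edges = ∅ := by
      refine Finset.eq_empty_of_forall_notMem fun e he => ?_
      obtain ⟨x, y, -, -, -, hpos, -⟩ := (hs e).1 he
      rw [Cmd.hubs_sem_zero y.2] at hpos
      exact hpos.false
    refine ⟨by simp [hempty], htarget.trans ?_⟩
    have hle : optBroadcast G α 0 ≤ broadcast (addEdges G s.edges) α := by
      refine Finset.sup'_le _ _ fun F hF => ?_
      have : F = ∅ := Finset.card_eq_zero.1 (Nat.le_zero.1 (Finset.mem_filter.1 hF).2)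
      rw [this, hempty]
    have hα : α ^ 2 ≤ 1 := pow_le_one₀ h0.le h1
    refine le_trans ?_ hle
    simpa using mul_le_of_le_one_left hopt hα
  have hp0 : ∀ u v, 0 ≤ natProximity G α u v := fun u v => by
    rw [natProximity]
    split_ifs
    · exact proximity_nonneg h0.le h1 _ _ _
    · exact le_rfl
  have hp1 : ∀ u v, natProximity G α u v ≤ 1 := fun u v => by
    rw [natProximity]
    split_ifs
    · exact proximity_le_one h0.le h1 _ _ _
    · exact zero_le_one
  have hpe : ∀ u v : Fin n, natProximity G α u v = proximity G α u v := fun u v => by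
    simp [natProximity]
  set B := optBroadcast G α k / (4 * (k : ℝ) ^ 2 + 1) with hBdef
  have hB0 : 0 ≤ B := by positivity
  obtain ⟨X, hX, hXcard, hXB⟩ : ∃ X ⊆ Finset.range n, X.card ≤ 2 * min k n ∧
      ∀ u < n, ∀ v < n, B ≤ natProximity G α u v ∨ ∃ x ∈ X, ∃ y ∈ X,
        B ≤ natProximity G α u x * natProximity G α v y := by
    -- The budget is capped at `n`, so for `k ≥ n` the hubs must number at most `2n`: take all
    -- vertices, each of which serves itself with proximity one.
    rcases le_total k n with hkn | hkn
    · obtain ⟨X, hX, h⟩ := exists_hubs h0.le h1 G k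
      refine ⟨X.map Fin.valEmbedding, fun x hx => ?_, ?_, fun u hu v hv => ?_⟩
      · obtain ⟨y, -, rfl⟩ := Finset.mem_map.1 hx
        exact Finset.mem_range.2 y.2
      · rwa [Finset.card_map, min_eq_left hkn]
      · rcases h ⟨u, hu⟩ ⟨v, hv⟩ with h | ⟨x, hx, y, hy, h⟩
        · exact Or.inl (h.trans (hpe ⟨u, hu⟩ ⟨v, hv⟩).ge)
        · refine Or.inr ⟨x, Finset.mem_map_of_mem _ hx, y, Finset.mem_map_of_mem _ hy, ?_⟩
          rw [hpe ⟨u, hu⟩ x, hpe ⟨v, hv⟩ y]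
          exact h
    · refine ⟨Finset.range n, subset_rfl, ?_, fun u hu v hv => Or.inr
        ⟨u, Finset.mem_range.2 hu, v, Finset.mem_range.2 hv, ?_⟩⟩
      · rw [Finset.card_range]
        omega
      · rw [hpe ⟨u, hu⟩ ⟨u, hu⟩, hpe ⟨v, hv⟩ ⟨v, hv⟩, proximity_self, proximity_self, one_mul]
        have : Nonempty (Fin n) := hG.nonempty
        exact (div_le_self hopt (by nlinarith [sq_nonneg (k : ℝ)])).trans
          (optBroadcast_le_one h0.le h1 G k)
  obtain ⟨S, hScard, hS14, hfail⟩ := Cmd.hubs_sem hn hk hp0 hp1 hX hXcard hXB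
  constructor
  · have hcard : s.edges.card ≤ S.card := by
      have hsub : s.edges ⊆ (S.subtype (· < n)).image
          fun y => s((⟨0, hn⟩ : Fin n), (⟨y.1, y.2⟩ : Fin n)) := by
        intro e he
        obtain ⟨x, y, hx, -, -, hpos, rfl⟩ := (hs e).1 he
        rw [hS14 y y.2] at hpos
        have hy : y.1 ∈ S := by
          by_contra hy
          simp [hy] at hpos
        refine Finset.mem_image.2 ⟨⟨y.1, y.2⟩, Finset.mem_subtype.2 hy, ?_⟩
        obtain rfl : x = ⟨0, hn⟩ := Fin.ext hx
        rfl
      refine (Finset.card_le_card hsub).trans (Finset.card_image_le.trans ?_)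
      rw [Finset.card_subtype]
      exact Finset.card_filter_le _ _
    -- For `n = 1` the logarithm vanishes and the star must have no edge at all.
    rcases Nat.lt_or_ge 1 n with hn2 | hn1
    · exact (Nat.cast_le.2 hcard).trans (hScard.trans (hub_bound hn2 hk))
    · have hempty : s.edges = ∅ := by
        refine Finset.eq_empty_of_forall_notMem fun e he => ?_
        obtain ⟨x, y, -, hyx, -⟩ := (hs e).1 he
        exact hyx (Fin.ext (by omega))
      obtain rfl : n = 1 := by omega
      simp [hempty]
  · refine htarget.trans (le_broadcast_star h0.le h1 (c := ⟨0, hn⟩) (S := {x | x.1 ∈ S})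
      (fun x hx => ?_) hB0 fun u v => ?_)
    · by_cases hxc : x = ⟨0, hn⟩
      · exact Or.inl hxc
      · right
        by_cases hadj : G.Adj ⟨0, hn⟩ x
        · exact Or.inl hadj
        · refine Or.inr ?_
          rw [SimpleGraph.fromEdgeSet_adj]
          refine ⟨(hs _).2 ⟨⟨0, hn⟩, x, rfl, hxc, hadj, ?_, rfl⟩, fun h => hxc h.symm⟩
          rw [hS14 x x.2, if_pos (show x.1 ∈ S from hx)]
          exact one_pos
    · have h := hfail u u.2 v v.2
      rw [serviceGap, sub_le_sub_iff_left, le_max_iff, hpe] at h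
      rcases h with h | h
      · exact Or.inl h
      -- For `B = 0` the value of `serve` may be the default of an empty fold, attained by no
      -- vertex, but then nothing has to be shown.
      rcases hB0.eq_or_lt with hB | hB
      · exact Or.inl (hB ▸ proximity_nonneg h0.le h1 _ _ _)
      have hpos := hB.trans_le h
      have hu := (pos_and_pos_or_neg_and_neg_of_mul_pos hpos).resolve_right fun h =>
        (serve_nonneg S u.1).not_gt h.1
      obtain ⟨x, hxS, hx, hux⟩ := exists_of_serve_pos hu.1
      obtain ⟨y, hyS, hy, hvy⟩ := exists_of_serve_pos hu.2
      refine Or.inr ⟨⟨x, hx⟩, hxS, ⟨y, hy⟩, hyS, ?_⟩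
      rw [← hpe, ← hpe, ← hux, ← hvy]
      exact h
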